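/- Let $n\ge 1$, $m\ge 1$, $\mathbb{R}^{n+1}_+=\{(x,t):x\in\mathbb{R}^n,\ t>0\}$, and write $z=(x,t)$, $z_j=(x_j,t_j)$, $w=(y,s)$ for points of $\mathbb{R}^{n+1}_+$. For $\alpha\in\mathbb{R}$ let $A^\infty_\alpha$ be the space of complex-valued harmonic functions $g$ on $\mathbb{R}^{n+1}_+$ with $\sup_{z}|g(z)|\,t^{\alpha}<\infty$. For $\vec s=(s_1,\dots,s_m)\in\mathbb{R}^m$ let $A^\infty_{\vec s}$ be the space of complex-valued functions $f$, harmonic on $(\mathbb{R}^{n+1}_+)^m\subset\mathbb{R}^{m(n+1)}$, with $\sup|f(z_1,\dots,z_m)|\,t_1^{s_1}\cdots t_m^{s_m}<\infty$, and let $\tilde hA^\infty_{\vec s}$ be the set of those $f\in A^\infty_{\vec s}$ that are harmonic in each of the variables $z_1,\dots,z_m$ separately. Put $\operatorname{Tr}f(z)=f(z,\dots,z)$ and $\operatorname{Trace}X=\{\operatorname{Tr}f:f\in X\}$. Let $$P(x,t)=c_n\frac{t}{(|x|^2+t^2)^{(n+1)/2}},\quad c_n=\frac{\Gamma(\frac{n+1}{2})}{\pi^{(n+1)/2}},\qquad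 Q_k(z,w)=\frac{(-2)^{k+1}}{k!}\,\frac{\partial^{k+1}}{\partial t^{k+1}}P(x-y,t+s)\quad(k=0,1,2,\dots).$$ **Theorem 5.** Let $s_1,\dots,s_m>-1$ and $\lambda=\sum_{j=1}^m s_j$. (i) If $s_j>0$ for all $j$, then $A^\infty_\lambda\subset\operatorname{Trace}\tilde hA^\infty_{\vec s}$. Moreover, for every integer $k\ge 0$ with $k>\lambda-1$ and every $g\in A^\infty_\lambda$, the integral $$f(z_1,\dots,z_m)=\int_{\mathbb{R}^{n+1}_+}Q_k\Big(\frac{z_1+\dots+z_m}{m},w\Big)\,g(w)\,s^k\,dw,\qquad z_j\in\mathbb{R}^{n+1}_+,$$ converges absolutely, and it defines a function $f\in\tilde hA^\infty_{\vec s}$ (so $f$ is separately harmonic and $|f|\le C\prod_j t_j^{-s_j}$) with $\operatorname{Tr}f=g$. (ii) Conversely, if $f\in A^\infty_{\vec s}$ and $\operatorname{Tr}f$ is harmonic on $\mathbb{R}^{n+1}_+$, then $\operatorname{Tr}f\in A^\infty_\lambda$. -/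

import Mathlib

open MeasureTheory InnerProductSpace

noncomputable section

namespace HarmonicTrace

/-- `ℝ^{n+1} = ℝ^n × ℝ` with its Euclidean norm; a point is `z = (x, t)` with `x = z.fst` and
`t = z.snd`. -/
abbrev Space (n : ℕ) : Type := WithLp 2 (EuclideanSpace ℝ (Fin n) × ℝ)

/-- The upper half space `ℝ_+^{n+1} = {(x, t) : t > 0}`. -/
def upperHalfSpace (n : ℕ) : Set (Space n) := {z | 0 < z.snd}

/-- The space `A_α^∞` on the upper half space: harmonic functions `g` for which
`|g(x, t)| t^α` is bounded. Values outside the half space are irrelevant. -/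
def GrowthSpace (n : ℕ) (α : ℝ) : Set (Space n → ℂ) :=
  {g | HarmonicOnNhd g (upperHalfSpace n) ∧
    ∃ C : ℝ, ∀ z ∈ upperHalfSpace n, ‖g z‖ * z.snd ^ α ≤ C}

/-- `h((ℝ_+^{n+1})^m)`: functions on the product of `m` half spaces that are harmonic in all
`m (n + 1)` real variables, the product being an open set of the Euclidean space
`(ℝ^{n+1})^m`. -/
def Harmonic (n m : ℕ) : Set ((Fin m → Space n) → ℂ) :=
  {f | HarmonicOnNhd (fun Z : PiLp 2 (fun _ : Fin m => Space n) => f (WithLp.ofLp Z))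
    {Z | ∀ j, Z j ∈ upperHalfSpace n}}

/-- The functions on `(ℝ_+^{n+1})^m` that are harmonic in each of the variables
`z_1, …, z_m` separately. -/
def SepHarmonic (n m : ℕ) : Set ((Fin m → Space n) → ℂ) :=
  {f | ∀ z : Fin m → Space n, (∀ j, z j ∈ upperHalfSpace n) →
    ∀ j, HarmonicOnNhd (fun ζ => f (Function.update z j ζ)) (upperHalfSpace n)}

/-- The space `A_s^∞` on `(ℝ_+^{n+1})^m`, for `s = (s_1, …, s_m)`: harmonic functions `f` for
which `|f(z_1, …, z_m)| t_1^{s_1} ⋯ t_m^{s_m}` is bounded. -/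
def ProdGrowthSpace (n : ℕ) {m : ℕ} (s : Fin m → ℝ) : Set ((Fin m → Space n) → ℂ) :=
  {f | f ∈ Harmonic n m ∧
    ∃ C : ℝ, ∀ z : Fin m → Space n, (∀ j, z j ∈ upperHalfSpace n) →
      ‖f z‖ * ∏ j, (z j).snd ^ s j ≤ C}

/-- The diagonal trace `Tr f (z) = f(z, …, z)`. -/
def tr {n m : ℕ} (f : (Fin m → Space n) → ℂ) : Space n → ℂ := fun z => f (fun _ => z)

/-- `Trace X = {Tr f : f ∈ X}`, as a set of functions on the upper half space (functions are
identified when they agree there). -/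
def traceSet {n m : ℕ} (X : Set ((Fin m → Space n) → ℂ)) : Set (Space n → ℂ) :=
  {g | ∃ f ∈ X, Set.EqOn (tr f) g (upperHalfSpace n)}

/-- The Poisson kernel `P(x, t) = c_n t / (|x|² + t²)^{(n+1)/2}` of the upper half space, with
`c_n = Γ((n+1)/2) / π^{(n+1)/2}`. -/
def poissonKernel {n : ℕ} (x : EuclideanSpace ℝ (Fin n)) (t : ℝ) : ℝ :=
  Real.Gamma (((n : ℝ) + 1) / 2) / Real.pi ^ (((n : ℝ) + 1) / 2) *
    (t / (‖x‖ ^ 2 + t ^ 2) ^ (((n : ℝ) + 1) / 2))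

/-- The Bergman kernel `Q_l(z, w) = ((-2)^{l+1} / l!) ∂_t^{l+1} P(x - y, t + s)`, where
`z = (x, t)` and `w = (y, s)`. -/
def bergmanKernel {n : ℕ} (l : ℕ) (z w : Space n) : ℝ :=
  (-2) ^ (l + 1) / (l.factorial : ℝ) *
    iteratedDeriv (l + 1) (fun t : ℝ => poissonKernel (z.fst - w.fst) (t + w.snd)) z.snd

/-- The integrand `w = (y, s) ↦ Q_k((z_1 + ⋯ + z_m)/m, w) g(w) s^k`. -/
def extensionIntegrand {n m : ℕ} (k : ℕ) (g : Space n → ℂ) (z : Fin m → Space n) :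
    Space n → ℂ :=
  fun w => (bergmanKernel k ((m : ℝ)⁻¹ • ∑ j, z j) w * w.snd ^ k) • g w

/-- The Bergman type integral
`∫ Q_k((z_1 + ⋯ + z_m)/m, w) g(w) s^k dw` over the upper half space. -/
def extension {n : ℕ} (m k : ℕ) (g : Space n → ℂ) : (Fin m → Space n) → ℂ :=
  fun z => ∫ w in upperHalfSpace n, extensionIntegrand k g z w

end HarmonicTrace

end

noncomputable section

namespace HarmonicTrace

open Topology Filter

/-! ### The Poisson kernel has mass one -/

/-! The extension of `g` is its composition with the average, `f(z_1, …, z_m) = g((z_1 + ⋯ +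
z_m)/m)`. In each variable the average is a dilation followed by a translation, and on the whole
product it is a multiple of a coisometry; both kinds of map preserve harmonicity. On the diagonal it
is the identity. Since all heights are positive, each `t_j` is at most `m` times the height of the
average, and the exponents `s_j` are positive, so the growth bound is inherited. The converse (ii)
is the restriction of the bound to the diagonal.

What remains is that the Bergman integral equals this `f`, that is, `Q_k` reproduces `g`
(`integral_bergmanKernel_smul`). On `t ≥ s` the function `g` is bounded, so it is the Poisson
integral of its values at height `s` (`eq_integral_poissonKernel_smul`). Differentiating `k + 1`
times in the normal direction and evaluating at distance `t + s` above height `s`, the integral over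
`y` of `∂_t^{k+1} P(x - y, t + s) g(y, s)` is `∂_t^{k+1} g(x, t + 2s)`. The remaining integral over
`s`, with weight `s^k`, undoes the derivatives by repeated integration by parts
(`integral_pow_smul_deriv_eq`). Absolute convergence comes from `|∂_t^j P| ≤ C t^{-j} P` and the
unit mass of `P`, which leave the integral of `(t + s)^{-k-1} s^{k-λ}`, finite for `0 < λ < k + 1`.

The Poisson representation is a uniqueness statement, proved by a maximum principle with an explicit
barrier. Harmonicity enters it only as vanishing of the limit of symmetric second differences: this
passes under the Poisson integral by dominated convergence, so no regularity of Poisson integrals is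
needed. -/

theorem integrable_one_add_norm_sq_rpow (n : ℕ) :
    Integrable (fun x : EuclideanSpace ℝ (Fin n) => (1 + ‖x‖ ^ 2) ^ (-(((n : ℝ) + 1) / 2))) := by
  have h := integrable_rpow_neg_one_add_norm_sq (E := EuclideanSpace ℝ (Fin n)) (μ := volume)
    (r := (n : ℝ) + 1) (by simp)
  simpa only [neg_div] using h

/-- Writing `Γ(a) q^{-a} = ∫ t^{a-1} e^{-qt} dt` with `q = 1 + ‖x‖²` and exchanging the integrals
makes the integral in `x` Gaussian; what is left in `t` is `π^{n/2} Γ(1/2)`. -/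
theorem integral_one_add_norm_sq_rpow (n : ℕ) :
    ∫ x : EuclideanSpace ℝ (Fin n), (1 + ‖x‖ ^ 2) ^ (-(((n : ℝ) + 1) / 2)) =
      Real.pi ^ (((n : ℝ) + 1) / 2) / Real.Gamma (((n : ℝ) + 1) / 2) := by
  set a : ℝ := ((n : ℝ) + 1) / 2 with ha
  have ha0 : 0 < a := by positivity
  have hG : 0 < Real.Gamma a := Real.Gamma_pos_of_pos ha0
  let F : EuclideanSpace ℝ (Fin n) → ℝ → ℝ := fun x t =>
    t ^ (a - 1) * Real.exp (-((1 + ‖x‖ ^ 2) * t))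
  have hinner : ∀ x, ∫ t in Set.Ioi (0 : ℝ), F x t = (1 + ‖x‖ ^ 2) ^ (-a) * Real.Gamma a := by
    intro x
    have h1 : (0 : ℝ) < 1 + ‖x‖ ^ 2 := by positivity
    rw [Real.integral_rpow_mul_exp_neg_mul_Ioi ha0 h1, one_div, Real.inv_rpow h1.le,
      Real.rpow_neg h1.le]
  have hFi : ∀ x, IntegrableOn (F x) (Set.Ioi (0 : ℝ)) := by
    intro x
    -- A non-integrable function would have integral `0` by convention, but `hinner` gives a
    -- positive value.
    by_contra hc
    have h := integral_undef hc
    rw [hinner] at h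
    have h1 : (0 : ℝ) < 1 + ‖x‖ ^ 2 := by positivity
    have := mul_pos (Real.rpow_pos_of_pos h1 (-a)) hG
    linarith
  have hprod : Integrable (Function.uncurry F)
      (volume.prod (volume.restrict (Set.Ioi (0 : ℝ)))) := by
    refine (integrable_prod_iff ?_).2 ⟨Filter.Eventually.of_forall hFi, ?_⟩
    · refine Measurable.aestronglyMeasurable ?_
      simp only [F, Function.uncurry_def]
      fun_prop
    · refine ((integrable_one_add_norm_sq_rpow n).mul_const (Real.Gamma a)).congr ?_
      refine Filter.Eventually.of_forall fun x => ?_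
      rw [← ha]
      simp only [Function.uncurry_apply_pair]
      rw [← hinner x]
      refine setIntegral_congr_fun measurableSet_Ioi fun t ht => ?_
      have ht : (0 : ℝ) < t := ht
      exact (Real.norm_of_nonneg (by positivity)).symm
  have hswap := integral_integral_swap hprod
  simp only [hinner] at hswap
  rw [integral_mul_const] at hswap
  have houter : ∀ t ∈ Set.Ioi (0 : ℝ), ∫ x, F x t =
      Real.pi ^ ((n : ℝ) / 2) * (t ^ ((1 / 2 : ℝ) - 1) * Real.exp (-(1 * t))) := by
    intro t ht
    have ht : (0 : ℝ) < t := ht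
    have h1 : ∀ x : EuclideanSpace ℝ (Fin n),
        F x t = t ^ (a - 1) * Real.exp (-t) * Real.exp (-t * ‖x‖ ^ 2) := by
      intro x
      simp only [F]
      rw [mul_assoc, ← Real.exp_add]
      congr 2
      ring
    simp only [h1]
    rw [integral_const_mul, GaussianFourier.integral_rexp_neg_mul_sq_norm ht,
      Real.div_rpow Real.pi_pos.le ht.le, finrank_euclideanSpace_fin]
    have h2 : t ^ ((1 / 2 : ℝ) - 1) = t ^ (a - 1) / t ^ ((n : ℝ) / 2) := by
      rw [← Real.rpow_sub ht]
      congr 1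
      rw [ha]
      ring
    rw [h2, one_mul]
    ring
  rw [setIntegral_congr_fun measurableSet_Ioi houter, integral_const_mul,
    Real.integral_rpow_mul_exp_neg_mul_Ioi (by norm_num) one_pos, Real.Gamma_one_half_eq] at hswap
  rw [eq_div_iff hG.ne', hswap, Real.sqrt_eq_rpow, div_one, Real.one_rpow, one_mul,
    ← Real.rpow_add Real.pi_pos, ha]
  congr 1
  ring

theorem poissonKernel_one_eq {n : ℕ} (x : EuclideanSpace ℝ (Fin n)) :
    poissonKernel x 1 = Real.Gamma (((n : ℝ) + 1) / 2) / Real.pi ^ (((n : ℝ) + 1) / 2) *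
      (1 + ‖x‖ ^ 2) ^ (-(((n : ℝ) + 1) / 2)) := by
  rw [poissonKernel, Real.rpow_neg (by positivity), one_pow, add_comm (‖x‖ ^ 2), one_div]

theorem integrable_poissonKernel_one (n : ℕ) :
    Integrable (fun x : EuclideanSpace ℝ (Fin n) => poissonKernel x 1) := by
  simp only [poissonKernel_one_eq]
  exact (integrable_one_add_norm_sq_rpow n).const_mul _

theorem integral_poissonKernel_one (n : ℕ) :
    ∫ x : EuclideanSpace ℝ (Fin n), poissonKernel x 1 = 1 := by
  simp only [poissonKernel_one_eq]
  rw [integral_const_mul, integral_one_add_norm_sq_rpow]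
  have : 0 < Real.Gamma (((n : ℝ) + 1) / 2) := Real.Gamma_pos_of_pos (by positivity)
  have : 0 < Real.pi ^ (((n : ℝ) + 1) / 2) := Real.rpow_pos_of_pos Real.pi_pos _
  field_simp

theorem poissonKernel_pos {n : ℕ} (x : EuclideanSpace ℝ (Fin n)) {t : ℝ} (ht : 0 < t) :
    0 < poissonKernel x t := by
  have : 0 < Real.Gamma (((n : ℝ) + 1) / 2) := Real.Gamma_pos_of_pos (by positivity)
  have : 0 < Real.pi ^ (((n : ℝ) + 1) / 2) := Real.rpow_pos_of_pos Real.pi_pos _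
  have : 0 < (‖x‖ ^ 2 + t ^ 2) ^ (((n : ℝ) + 1) / 2) := Real.rpow_pos_of_pos (by positivity) _
  rw [poissonKernel]
  positivity

theorem poissonKernel_eq_scale {n : ℕ} (x : EuclideanSpace ℝ (Fin n)) {t : ℝ} (ht : 0 < t) :
    poissonKernel x t = (t ^ n)⁻¹ * poissonKernel (t⁻¹ • x) 1 := by
  have h : ‖t⁻¹ • x‖ ^ 2 + 1 ^ 2 = (‖x‖ ^ 2 + t ^ 2) / t ^ 2 := by
    rw [norm_smul, Real.norm_of_nonneg (by positivity)]
    field_simp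
  have h2 : (t ^ 2) ^ (((n : ℝ) + 1) / 2) = t ^ (n + 1) := by
    rw [← Real.rpow_natCast_mul ht.le, ← Real.rpow_natCast]
    congr 1
    push_cast
    ring
  rw [poissonKernel, poissonKernel, h, Real.div_rpow (by positivity) (by positivity), h2]
  have : 0 < (‖x‖ ^ 2 + t ^ 2) ^ (((n : ℝ) + 1) / 2) := Real.rpow_pos_of_pos (by positivity) _
  field_simp
  ring

theorem integrable_poissonKernel (n : ℕ) {t : ℝ} (ht : 0 < t) :
    Integrable (fun x : EuclideanSpace ℝ (Fin n) => poissonKernel x t) := by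
  simp only [poissonKernel_eq_scale _ ht]
  exact ((integrable_poissonKernel_one n).comp_smul (inv_ne_zero ht.ne')).const_mul _

theorem integral_poissonKernel (n : ℕ) {t : ℝ} (ht : 0 < t) :
    ∫ x : EuclideanSpace ℝ (Fin n), poissonKernel x t = 1 := by
  simp only [poissonKernel_eq_scale _ ht]
  rw [integral_const_mul, Measure.integral_comp_smul volume
    (fun x : EuclideanSpace ℝ (Fin n) => poissonKernel x 1), integral_poissonKernel_one,
    finrank_euclideanSpace_fin, abs_of_pos (by positivity), smul_eq_mul, mul_one, inv_pow, inv_inv,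
    inv_mul_cancel₀ (pow_ne_zero n ht.ne')]

/-! ### Derivatives of the Poisson kernel in the last variable -/

open Polynomial in
/-- The polynomials `p_j` with `∂_t^j P(x, t) = P(x, t) t^{-j} p_j(t² / (|x|² + t²))`. -/
def derivPoly (n : ℕ) : ℕ → Polynomial ℝ
  | 0 => 1
  | j + 1 => (C (1 - (j : ℝ)) - C ((n : ℝ) + 1) * X) * derivPoly n j +
      C 2 * (X - X ^ 2) * derivative (derivPoly n j)

/-- The `j`-th derivative of the Poisson kernel in `t`, in closed form. -/
def poissonDeriv {n : ℕ} (j : ℕ) (x : EuclideanSpace ℝ (Fin n)) (t : ℝ) : ℝ :=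
  poissonKernel x t * (t⁻¹) ^ j * (derivPoly n j).eval (t ^ 2 / (‖x‖ ^ 2 + t ^ 2))

theorem poissonDeriv_zero {n : ℕ} (x : EuclideanSpace ℝ (Fin n)) (t : ℝ) :
    poissonDeriv 0 x t = poissonKernel x t := by
  simp [poissonDeriv, derivPoly]

theorem hasDerivAt_poissonKernel {n : ℕ} (x : EuclideanSpace ℝ (Fin n)) {t : ℝ} (ht : 0 < t) :
    HasDerivAt (poissonKernel x)
      (poissonKernel x t * t⁻¹ * (1 - ((n : ℝ) + 1) * (t ^ 2 / (‖x‖ ^ 2 + t ^ 2)))) t := by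
  have hq : 0 < ‖x‖ ^ 2 + t ^ 2 := by positivity
  have hqr : 0 < (‖x‖ ^ 2 + t ^ 2) ^ (((n : ℝ) + 1) / 2) := Real.rpow_pos_of_pos hq _
  have h1 : HasDerivAt (fun t : ℝ => ‖x‖ ^ 2 + t ^ 2) (2 * t) t := by
    simpa using ((hasDerivAt_pow 2 t).const_add (‖x‖ ^ 2))
  have h2 := h1.rpow_const (p := ((n : ℝ) + 1) / 2) (Or.inl hq.ne')
  have h3 := ((hasDerivAt_id t).div h2 hqr.ne').const_mul
    (Real.Gamma (((n : ℝ) + 1) / 2) / Real.pi ^ (((n : ℝ) + 1) / 2))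
  refine h3.congr_deriv ?_
  rw [poissonKernel, Real.rpow_sub_one hq.ne']
  simp only [id]
  field_simp

/-- With `u = t² / (‖x‖² + t²)` one has `t ∂_t u = 2(u - u²)` and `t ∂_t P = (1 - (n+1)u) P`, while
`t^{-j}` contributes `-j`. This is the recursion of `derivPoly`. -/
theorem hasDerivAt_poissonDeriv {n : ℕ} (j : ℕ) (x : EuclideanSpace ℝ (Fin n)) {t : ℝ}
    (ht : 0 < t) : HasDerivAt (poissonDeriv j x) (poissonDeriv (j + 1) x t) t := by
  have hq : 0 < ‖x‖ ^ 2 + t ^ 2 := by positivity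
  have h1 : HasDerivAt (fun t : ℝ => ‖x‖ ^ 2 + t ^ 2) (2 * t) t := by
    simpa using ((hasDerivAt_pow 2 t).const_add (‖x‖ ^ 2))
  have h2 : HasDerivAt (fun t : ℝ => t ^ 2) (2 * t) t := by simpa using hasDerivAt_pow 2 t
  have h3 := ((derivPoly n j).hasDerivAt (t ^ 2 / (‖x‖ ^ 2 + t ^ 2))).comp t (h2.div h1 hq.ne')
  have h4 := ((hasDerivAt_poissonKernel x ht).mul ((hasDerivAt_inv ht.ne').pow j)).mul h3
  refine h4.congr_deriv ?_
  simp only [poissonDeriv, derivPoly, Polynomial.eval_add, Polynomial.eval_mul,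
    Polynomial.eval_sub, Polynomial.eval_C, Polynomial.eval_X, Polynomial.eval_pow,
    Function.comp_apply, Pi.mul_apply, Pi.pow_apply]
  generalize (derivPoly n j).eval _ = p
  generalize (Polynomial.derivative (derivPoly n j)).eval _ = p'
  generalize poissonKernel x t = K
  -- The derivative of `t⁻¹ ^ j` carries the truncated exponent `j - 1`, so `j = 0` is separate.
  rcases j with _ | j
  · simp
    field_simp
  · simp only [Nat.add_sub_cancel, inv_pow]
    push_cast
    field_simp
    ring

theorem iteratedDeriv_poissonKernel {n : ℕ} (j : ℕ) (x : EuclideanSpace ℝ (Fin n)) {t : ℝ}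
    (ht : 0 < t) : iteratedDeriv j (poissonKernel x) t = poissonDeriv j x t := by
  induction j generalizing t with
  | zero => rw [iteratedDeriv_zero, poissonDeriv_zero]
  | succ j ih =>
    rw [iteratedDeriv_succ]
    have : iteratedDeriv j (poissonKernel x) =ᶠ[nhds t] poissonDeriv j x := by
      filter_upwards [lt_mem_nhds ht] with τ hτ using ih hτ
    rw [this.deriv_eq, (hasDerivAt_poissonDeriv j x ht).deriv]

/-! ### Bounds and continuity of the kernel and its normal derivatives -/

theorem exists_abs_poissonDeriv_le (n j : ℕ) :
    ∃ C : ℝ, 0 < C ∧ ∀ (x : EuclideanSpace ℝ (Fin n)) (t : ℝ), 0 < t →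
      |poissonDeriv j x t| ≤ C * (t⁻¹) ^ j * poissonKernel x t := by
  obtain ⟨C, hC⟩ := (isCompact_Icc (a := (0 : ℝ)) (b := 1)).exists_bound_of_continuousOn
    (derivPoly n j).continuous.continuousOn
  refine ⟨max C 1, by positivity, fun x t ht => ?_⟩
  have hq : 0 < ‖x‖ ^ 2 + t ^ 2 := by positivity
  -- The polynomial is only evaluated on `[0, 1]`, where it is bounded.
  have hu : t ^ 2 / (‖x‖ ^ 2 + t ^ 2) ∈ Set.Icc (0 : ℝ) 1 :=
    ⟨by positivity, (div_le_one hq).2 (by nlinarith [sq_nonneg ‖x‖])⟩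
  have hP := poissonKernel_pos x ht
  rw [poissonDeriv, abs_mul, abs_of_pos (by positivity), mul_comm, mul_comm (poissonKernel x t),
    ← mul_assoc]
  gcongr
  exact (hC _ hu).trans (le_max_left _ _)

theorem poissonKernel_le_of_mem_Icc {n : ℕ} (x : EuclideanSpace ℝ (Fin n)) {t τ : ℝ} (hτ : 0 < τ)
    (ht : t ∈ Set.Icc (τ / 2) (2 * τ)) : poissonKernel x t ≤ 4 * poissonKernel x (τ / 2) := by
  have h0 : 0 < Real.Gamma (((n : ℝ) + 1) / 2) := Real.Gamma_pos_of_pos (by positivity)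
  have h1 : 0 < Real.pi ^ (((n : ℝ) + 1) / 2) := Real.rpow_pos_of_pos Real.pi_pos _
  have h2 : 0 < (‖x‖ ^ 2 + (τ / 2) ^ 2) ^ (((n : ℝ) + 1) / 2) :=
    Real.rpow_pos_of_pos (by positivity) _
  have h3 : t / (‖x‖ ^ 2 + t ^ 2) ^ (((n : ℝ) + 1) / 2) ≤
      (2 * τ) / (‖x‖ ^ 2 + (τ / 2) ^ 2) ^ (((n : ℝ) + 1) / 2) := by
    gcongr
    · exact ht.2
    · exact ht.1
  rw [poissonKernel, poissonKernel]
  calc _ ≤ Real.Gamma (((n : ℝ) + 1) / 2) / Real.pi ^ (((n : ℝ) + 1) / 2) *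
        ((2 * τ) / (‖x‖ ^ 2 + (τ / 2) ^ 2) ^ (((n : ℝ) + 1) / 2)) := by gcongr
    _ = _ := by ring

theorem continuousOn_poissonKernel (n : ℕ) :
    ContinuousOn (fun w : EuclideanSpace ℝ (Fin n) × ℝ => poissonKernel w.1 w.2)
      {w | 0 < w.2} := by
  have hq : ∀ w ∈ {w : EuclideanSpace ℝ (Fin n) × ℝ | 0 < w.2}, 0 < ‖w.1‖ ^ 2 + w.2 ^ 2 := by
    intro w hw
    have : 0 < w.2 := hw
    positivity
  unfold poissonKernel
  refine ContinuousOn.mul continuousOn_const (ContinuousOn.div (by fun_prop) ?_ ?_)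
  · exact ContinuousOn.rpow_const (by fun_prop) fun w hw => Or.inl (hq w hw).ne'
  · exact fun w hw => (Real.rpow_pos_of_pos (hq w hw) _).ne'

theorem continuousOn_poissonDeriv (n j : ℕ) :
    ContinuousOn (fun w : EuclideanSpace ℝ (Fin n) × ℝ => poissonDeriv j w.1 w.2)
      {w | 0 < w.2} := by
  have hq : ∀ w ∈ {w : EuclideanSpace ℝ (Fin n) × ℝ | 0 < w.2}, ‖w.1‖ ^ 2 + w.2 ^ 2 ≠ 0 := by
    intro w hw
    have : 0 < w.2 := hw
    positivity
  unfold poissonDeriv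
  refine ((continuousOn_poissonKernel n).mul ?_).mul ?_
  · exact (ContinuousOn.inv₀ (by fun_prop) fun w hw => ne_of_gt hw).pow j
  · exact (derivPoly n j).continuous.comp_continuousOn
      (ContinuousOn.div (by fun_prop) (by fun_prop) hq)

theorem continuous_poissonDeriv {n : ℕ} (j : ℕ) {t : ℝ} (ht : 0 < t) :
    Continuous (fun x : EuclideanSpace ℝ (Fin n) => poissonDeriv j x t) :=
  (continuousOn_poissonDeriv n j).comp_continuous (f := fun x => (x, t)) (by fun_prop)
    fun _ => ht

theorem continuous_poissonKernel {n : ℕ} {t : ℝ} (ht : 0 < t) :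
    Continuous (fun x : EuclideanSpace ℝ (Fin n) => poissonKernel x t) := by
  simpa only [poissonDeriv_zero] using continuous_poissonDeriv (n := n) 0 ht

/-! ### Symmetric second differences and the maximum principle -/

/-- The sum of the symmetric second differences of `v` at `z` along an orthonormal basis. -/
def secondDiff {n : ℕ} {F : Type*} [AddCommGroup F] (v : Space n → F) (z : Space n) (r : ℝ) : F :=
  ∑ i, (v (z + r • stdOrthonormalBasis ℝ (Space n) i) +
    v (z - r • stdOrthonormalBasis ℝ (Space n) i) - (v z + v z))

/-- The generalized Laplacian of `v` at `z`, defined by symmetric second differences, vanishes. -/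
def WeaklyHarmonicAt {n : ℕ} {F : Type*} [NormedAddCommGroup F] [NormedSpace ℝ F]
    (v : Space n → F) (z : Space n) : Prop :=
  Tendsto (fun r : ℝ => (r ^ 2)⁻¹ • secondDiff v z r) (𝓝[>] 0) (𝓝 0)

theorem secondDiff_sub {n : ℕ} {F : Type*} [AddCommGroup F] (v w : Space n → F)
    (z : Space n) (r : ℝ) :
    secondDiff (fun z => v z - w z) z r = secondDiff v z r - secondDiff w z r := by
  rw [secondDiff, secondDiff, secondDiff, ← Finset.sum_sub_distrib]
  exact Finset.sum_congr rfl fun i _ => by abel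

section WeaklyHarmonic

variable {n : ℕ} {F G : Type*} [NormedAddCommGroup F] [NormedSpace ℝ F]
  [NormedAddCommGroup G] [NormedSpace ℝ G]

theorem secondDiff_clm_comp (L : F →L[ℝ] G) (v : Space n → F) (z : Space n) (r : ℝ) :
    secondDiff (fun z => L (v z)) z r = L (secondDiff v z r) := by
  simp [secondDiff]

theorem WeaklyHarmonicAt.clm_comp {v : Space n → F} {z : Space n} (h : WeaklyHarmonicAt v z)
    (L : F →L[ℝ] G) : WeaklyHarmonicAt (fun z => L (v z)) z := by
  have := (L.continuous.tendsto 0).comp h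
  rw [map_zero] at this
  refine this.congr fun r => ?_
  simp [secondDiff_clm_comp]

theorem WeaklyHarmonicAt.sub {v w : Space n → F} {z : Space n} (hv : WeaklyHarmonicAt v z)
    (hw : WeaklyHarmonicAt w z) : WeaklyHarmonicAt (fun z => v z - w z) z := by
  have := Tendsto.sub hv hw
  rw [sub_zero] at this
  refine this.congr fun r => ?_
  rw [secondDiff_sub, smul_sub]

end WeaklyHarmonic

theorem isOpen_upperHalfSpace (n : ℕ) : IsOpen (upperHalfSpace n) :=
  isOpen_lt continuous_const (by fun_prop)

theorem snd_eq_inner {n : ℕ} (z : Space n) : z.snd = inner ℝ z (WithLp.toLp 2 (0, 1)) := by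
  simp [WithLp.prod_inner_apply]

theorem norm_sq_eq {n : ℕ} (z : Space n) : ‖z‖ ^ 2 = ‖z.fst‖ ^ 2 + z.snd ^ 2 := by
  rw [WithLp.prod_norm_sq_eq_of_L2]
  simp

theorem sum_inner_mul_snd_basis {n : ℕ} (z : Space n) :
    ∑ i, inner ℝ z (stdOrthonormalBasis ℝ (Space n) i) *
      (stdOrthonormalBasis ℝ (Space n) i).snd = z.snd := by
  simp only [snd_eq_inner]
  exact (stdOrthonormalBasis ℝ (Space n)).sum_inner_mul_inner z _

theorem sum_snd_sq_basis (n : ℕ) :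
    ∑ i, (stdOrthonormalBasis ℝ (Space n) i).snd ^ 2 = 1 := by
  have h := sum_inner_mul_snd_basis (WithLp.toLp 2 (0, 1) : Space n)
  rw [← show (WithLp.toLp 2 ((0 : EuclideanSpace ℝ (Fin n)), (1 : ℝ)) : Space n).snd = 1 from rfl,
    ← h]
  refine Finset.sum_congr rfl fun i _ => ?_
  rw [sq, real_inner_comm, ← snd_eq_inner]

theorem finrank_space (n : ℕ) : Module.finrank ℝ (Space n) = n + 1 := by
  rw [(WithLp.linearEquiv 2 ℝ (EuclideanSpace ℝ (Fin n) × ℝ)).finrank_eq]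
  simp

theorem sum_norm_fst_sq_basis (n : ℕ) :
    ∑ i, ‖(stdOrthonormalBasis ℝ (Space n) i).fst‖ ^ 2 = n := by
  have h : ∀ i, ‖(stdOrthonormalBasis ℝ (Space n) i).fst‖ ^ 2 =
      1 - (stdOrthonormalBasis ℝ (Space n) i).snd ^ 2 := by
    intro i
    have := norm_sq_eq (stdOrthonormalBasis ℝ (Space n) i)
    rw [OrthonormalBasis.norm_eq_one] at this
    linarith
  simp only [h, Finset.sum_sub_distrib, sum_snd_sq_basis]
  simp [finrank_space]

/-- A superharmonic function on the half space which is at least `1` on the lateral and the upper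
boundary of the box of size `R`, and nonnegative on its base. -/
def barrier {n : ℕ} (R : ℝ) (z : Space n) : ℝ :=
  (‖z.fst‖ ^ 2 - ((n : ℝ) + 1) * z.snd ^ 2) / R ^ 2 + ((n : ℝ) + 2) * z.snd / R

/-- The linear terms cancel, and over an orthonormal basis the quadratic part sums to `n - (n + 1) =
-1`. -/
theorem secondDiff_barrier {n : ℕ} (R : ℝ) (z : Space n) (r : ℝ) :
    secondDiff (barrier R) z r = -(2 * r ^ 2 / R ^ 2) := by
  have h : ∀ i, (barrier R (z + r • stdOrthonormalBasis ℝ (Space n) i) +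
      barrier R (z - r • stdOrthonormalBasis ℝ (Space n) i) - (barrier R z + barrier R z)) =
      2 * r ^ 2 / R ^ 2 * (‖(stdOrthonormalBasis ℝ (Space n) i).fst‖ ^ 2 -
        ((n : ℝ) + 1) * (stdOrthonormalBasis ℝ (Space n) i).snd ^ 2) := by
    intro i
    simp only [barrier, WithLp.add_fst, WithLp.sub_fst, WithLp.smul_fst, WithLp.add_snd,
      WithLp.sub_snd, WithLp.smul_snd, norm_add_sq_real, norm_sub_sq_real, norm_smul, mul_pow,
      smul_eq_mul, Real.norm_eq_abs, sq_abs]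
    ring
  rw [secondDiff]
  simp only [h]
  rw [← Finset.mul_sum, Finset.sum_sub_distrib, ← Finset.mul_sum, sum_snd_sq_basis,
    sum_norm_fst_sq_basis]
  ring

theorem secondDiff_nonpos_of_isLocalMax {n : ℕ} {v : Space n → ℝ} {z : Space n}
    (h : IsLocalMax v z) : ∀ᶠ r in 𝓝 (0 : ℝ), secondDiff v z r ≤ 0 := by
  have h' : ∀ᶠ y in 𝓝 z, v y ≤ v z := h
  have hall : ∀ᶠ r in 𝓝 (0 : ℝ), ∀ i,
      v (z + r • stdOrthonormalBasis ℝ (Space n) i) ≤ v z ∧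
      v (z - r • stdOrthonormalBasis ℝ (Space n) i) ≤ v z := by
    rw [eventually_all]
    intro i
    have hp : Tendsto (fun r : ℝ => z + r • stdOrthonormalBasis ℝ (Space n) i) (𝓝 0) (𝓝 z) := by
      have : Continuous (fun r : ℝ => z + r • stdOrthonormalBasis ℝ (Space n) i) := by fun_prop
      simpa using this.tendsto 0
    have hm : Tendsto (fun r : ℝ => z - r • stdOrthonormalBasis ℝ (Space n) i) (𝓝 0) (𝓝 z) := by
      have : Continuous (fun r : ℝ => z - r • stdOrthonormalBasis ℝ (Space n) i) := by fun_prop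
      simpa using this.tendsto 0
    exact (hp.eventually h').and (hm.eventually h')
  filter_upwards [hall] with r hr
  refine Finset.sum_nonpos fun i _ => ?_
  linarith [(hr i).1, (hr i).2]

/-- At a maximum of `v - M * barrier R` over the box, either the point is on the boundary, where the
data make the difference nonpositive, or it is interior. The latter is impossible: second
differences at a local maximum are nonpositive, but here their normalized limit is `2M / R² > 0`. -/
theorem le_mul_barrier {n : ℕ} {v : Space n → ℝ} (hc : ContinuousOn v {z | 0 ≤ z.snd})
    (hh : ∀ z ∈ upperHalfSpace n, WeaklyHarmonicAt v z) (h0 : ∀ z, z.snd = 0 → v z ≤ 0)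
    {M : ℝ} (hM0 : 0 < M) (hM : ∀ z, 0 ≤ z.snd → v z ≤ M) {R : ℝ} (hR : 0 < R) {z : Space n}
    (hz : ‖z.fst‖ ≤ R) (hz0 : 0 ≤ z.snd) (hzR : z.snd ≤ R) : v z ≤ M * barrier R z := by
  set D : Set (Space n) := {z | ‖z.fst‖ ≤ R ∧ 0 ≤ z.snd ∧ z.snd ≤ R} with hD
  have hDc : IsCompact D := by
    refine Metric.isCompact_of_isClosed_isBounded ?_ ?_
    · have c1 : IsClosed {z : Space n | ‖z.fst‖ ≤ R} := isClosed_le (by fun_prop) (by fun_prop)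
      have c2 : IsClosed {z : Space n | 0 ≤ z.snd} := isClosed_le (by fun_prop) (by fun_prop)
      have c3 : IsClosed {z : Space n | z.snd ≤ R} := isClosed_le (by fun_prop) (by fun_prop)
      exact c1.inter (c2.inter c3)
    · refine (Metric.isBounded_closedBall (x := (0 : Space n)) (r := 2 * R)).subset ?_
      rintro z ⟨h1, h2, h3⟩
      rw [mem_closedBall_zero_iff]
      refine abs_le_of_sq_le_sq' ?_ (by positivity) |>.2
      rw [norm_sq_eq]
      nlinarith [norm_nonneg z.fst]
  have hbc : Continuous (barrier R : Space n → ℝ) := by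
    unfold barrier
    fun_prop
  obtain ⟨z₀, hz₀, hmax⟩ := hDc.exists_isMaxOn ⟨z, hz, hz0, hzR⟩
    (f := fun z => v z - M * barrier R z)
    ((hc.mono fun z hz => hz.2.1).sub (hbc.const_mul M).continuousOn)
  suffices hle : v z₀ - M * barrier R z₀ ≤ 0 by
    have := hmax (show z ∈ D from ⟨hz, hz0, hzR⟩)
    change v z - M * barrier R z ≤ v z₀ - M * barrier R z₀ at this
    linarith
  obtain ⟨h1, h2, h3⟩ := hz₀
  have hx := norm_nonneg z₀.fst
  -- For `0 ≤ t ≤ R` the last factor is at least `R`, so the product is nonnegative; it equals `R²`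
  -- when `t = R`.
  have hbarrier : R ^ 2 * barrier R z₀ =
      ‖z₀.fst‖ ^ 2 + z₀.snd * (((n : ℝ) + 2) * R - ((n : ℝ) + 1) * z₀.snd) := by
    rw [barrier]
    field_simp
    ring
  have hn : (0 : ℝ) ≤ n := n.cast_nonneg
  have hR2 : 0 < R ^ 2 := by positivity
  have hprod : 0 ≤ z₀.snd * (((n : ℝ) + 2) * R - ((n : ℝ) + 1) * z₀.snd) :=
    mul_nonneg h2 (by nlinarith)
  have hside : 1 ≤ barrier R z₀ → v z₀ - M * barrier R z₀ ≤ 0 := by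
    intro h
    nlinarith [hM z₀ h2]
  rcases h2.eq_or_lt with h2 | h2
  · have hb : 0 ≤ barrier R z₀ := by
      have : 0 ≤ R ^ 2 * barrier R z₀ := by rw [hbarrier]; positivity
      exact nonneg_of_mul_nonneg_right this hR2
    nlinarith [h0 z₀ h2.symm, mul_nonneg hM0.le hb]
  rcases h1.eq_or_lt with h1 | h1
  · refine hside (le_of_mul_le_mul_left ?_ hR2)
    rw [hbarrier, h1]
    linarith
  rcases h3.eq_or_lt with h3 | h3
  · refine hside (le_of_mul_le_mul_left ?_ hR2)
    rw [hbarrier, h3]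
    nlinarith [sq_nonneg ‖z₀.fst‖]
  exfalso
  have hnhds : D ∈ 𝓝 z₀ := by
    have c1 : IsOpen {z : Space n | ‖z.fst‖ < R} := isOpen_lt (by fun_prop) (by fun_prop)
    have c3 : IsOpen {z : Space n | z.snd < R} := isOpen_lt (by fun_prop) (by fun_prop)
    have h4 := c1.inter ((isOpen_upperHalfSpace n).inter c3)
    exact mem_of_superset (h4.mem_nhds ⟨h1, h2, h3⟩) fun z hz => ⟨hz.1.le, hz.2.1.le, hz.2.2.le⟩
  have hneg := secondDiff_nonpos_of_isLocalMax (hmax.isLocalMax hnhds)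
  have hlim : Tendsto (fun r : ℝ => (r ^ 2)⁻¹ • secondDiff (fun z => v z - M * barrier R z) z₀ r)
      (𝓝[>] 0) (𝓝 (0 + 2 * M / R ^ 2)) := by
    refine ((hh z₀ h2).add tendsto_const_nhds).congr' ?_
    filter_upwards [self_mem_nhdsWithin] with r hr
    have hr : (0 : ℝ) < r := hr
    have h5 : secondDiff (fun z => M * barrier R z) z₀ r = M * secondDiff (barrier R) z₀ r := by
      rw [secondDiff, secondDiff, Finset.mul_sum]
      exact Finset.sum_congr rfl fun i _ => by ring
    rw [secondDiff_sub, h5, secondDiff_barrier, smul_eq_mul, smul_eq_mul]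
    field_simp
    ring
  have hle := le_of_tendsto hlim (b := 0) (by
    filter_upwards [hneg.filter_mono nhdsWithin_le_nhds] with r hr
    exact mul_nonpos_of_nonneg_of_nonpos (by positivity) hr)
  have : 0 < 2 * M / R ^ 2 := by positivity
  linarith

/-- The maximum principle for bounded functions on the half space. -/
theorem nonpos_of_weaklyHarmonic {n : ℕ} {v : Space n → ℝ} (hc : ContinuousOn v {z | 0 ≤ z.snd})
    (hh : ∀ z ∈ upperHalfSpace n, WeaklyHarmonicAt v z) (h0 : ∀ z, z.snd = 0 → v z ≤ 0)
    {M : ℝ} (hM : ∀ z, 0 ≤ z.snd → v z ≤ M) {z : Space n} (hz : 0 ≤ z.snd) : v z ≤ 0 := by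
  have hM' : ∀ z : Space n, 0 ≤ z.snd → v z ≤ max M 1 :=
    fun z hz => (hM z hz).trans (le_max_left _ _)
  -- At a fixed point the barrier tends to `0` as the box exhausts the half space.
  have hlim : Tendsto (fun R : ℝ => max M 1 * barrier R z) atTop (𝓝 (max M 1 * (0 + 0))) := by
    refine Tendsto.const_mul _ (Tendsto.add ?_ ?_)
    · exact tendsto_const_nhds.div_atTop (tendsto_pow_atTop two_ne_zero)
    · exact tendsto_const_nhds.div_atTop tendsto_id
  rw [add_zero, mul_zero] at hlim
  refine ge_of_tendsto hlim ?_
  filter_upwards [eventually_ge_atTop ‖z.fst‖, eventually_ge_atTop z.snd, eventually_gt_atTop 0]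
    with R h1 h2 h3
  exact le_mul_barrier hc hh h0 (by positivity) hM' h3 h1 hz h2

/-- A bounded function on the half space that is harmonic in the sense of symmetric differences
and has boundary values `0` vanishes. -/
theorem eq_zero_of_weaklyHarmonic {n : ℕ} {v : Space n → ℂ}
    (hc : ContinuousOn v {z | 0 ≤ z.snd}) (hh : ∀ z ∈ upperHalfSpace n, WeaklyHarmonicAt v z)
    (h0 : ∀ z, z.snd = 0 → v z = 0) {M : ℝ} (hM : ∀ z, 0 ≤ z.snd → ‖v z‖ ≤ M) {z : Space n}
    (hz : 0 ≤ z.snd) : v z = 0 := by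
  -- The real functional `w ↦ Re(conj(v z) w)` takes the value `|v z|²` at `w = v z`, so the real
  -- maximum principle forces `v z = 0`.
  let L : ℂ →L[ℝ] ℝ := Complex.reCLM.comp
    (ContinuousLinearMap.mul ℝ ℂ ((starRingEnd ℂ) (v z)))
  have hL : ∀ w, L w = ((starRingEnd ℂ) (v z) * w).re := fun w => rfl
  have h := nonpos_of_weaklyHarmonic (v := fun z => L (v z)) (M := ‖L‖ * M)
    (L.continuous.comp_continuousOn hc) (fun z hz => (hh z hz).clm_comp L)
    (fun z hz => by rw [h0 z hz, map_zero])
    (fun z hz => (le_abs_self _).trans ((L.le_opNorm _).trans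
      (mul_le_mul_of_nonneg_left (hM z hz) (norm_nonneg L)))) hz
  rw [hL, mul_comm, Complex.mul_conj, Complex.ofReal_re] at h
  exact Complex.normSq_eq_zero.1 (le_antisymm h (Complex.normSq_nonneg _))

/-! ### Symmetric second differences of twice differentiable functions -/

section SecondDifference

variable {F : Type*} [NormedAddCommGroup F] [NormedSpace ℝ F]

theorem hasDerivAt_add_comp_neg {φ φ' : ℝ → F} {r : ℝ} (h : HasDerivAt φ (φ' r) r)
    (h' : HasDerivAt φ (φ' (-r)) (-r)) :
    HasDerivAt (fun r => φ r + φ (-r)) (φ' r - φ' (-r)) r := by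
  have := h.add (h'.scomp r (hasDerivAt_neg r))
  refine this.congr_deriv ?_
  rw [neg_one_smul, sub_eq_add_neg]

/-- The mean value inequality is applied to `φ(ρ) + φ(-ρ) - ρ² c`, whose derivative is `o(ρ)`. Thus
`φ'` need only be differentiable at `0`. -/
theorem tendsto_second_difference {φ φ' : ℝ → F} {c : F}
    (h : ∀ᶠ r in 𝓝 (0 : ℝ), HasDerivAt φ (φ' r) r) (h' : HasDerivAt φ' c 0) :
    Tendsto (fun r : ℝ => (r ^ 2)⁻¹ • (φ r + φ (-r) - (φ 0 + φ 0))) (𝓝[>] 0) (𝓝 c) := by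
  rw [Metric.tendsto_nhds]
  intro ε hε
  have hlo := (hasDerivAt_iff_isLittleO.1 h').def (show 0 < ε / 4 by positivity)
  obtain ⟨δ, hδ, hball⟩ := Metric.eventually_nhds_iff.1 (h.and hlo)
  filter_upwards [Ioo_mem_nhdsGT hδ] with r hr
  have hψ : ∀ ρ ∈ Set.Icc (0 : ℝ) r, HasDerivWithinAt (fun ρ => φ ρ + φ (-ρ) - ρ ^ 2 • c)
      (φ' ρ - φ' (-ρ) - (2 * ρ) • c) (Set.Icc 0 r) ρ := by
    intro ρ hρ
    have h1 := (hball (y := ρ) (by simp [abs_of_nonneg hρ.1]; linarith [hρ.2, hr.2])).1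
    have h2 := (hball (y := -ρ) (by simp [abs_of_nonneg hρ.1]; linarith [hρ.2, hr.2])).1
    have h3 : HasDerivAt (fun ρ : ℝ => ρ ^ 2 • c) ((2 * ρ) • c) ρ := by
      simpa using (hasDerivAt_pow 2 ρ).smul_const c
    exact ((hasDerivAt_add_comp_neg h1 h2).sub h3).hasDerivWithinAt
  have hb : ∀ ρ ∈ Set.Ico (0 : ℝ) r, ‖φ' ρ - φ' (-ρ) - (2 * ρ) • c‖ ≤ ε / 2 * r := by
    intro ρ hρ
    have h1 := (hball (y := ρ) (by simp [abs_of_nonneg hρ.1]; linarith [hρ.2, hr.2])).2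
    have h2 := (hball (y := -ρ) (by simp [abs_of_nonneg hρ.1]; linarith [hρ.2, hr.2])).2
    rw [sub_zero, Real.norm_eq_abs] at h1 h2
    rw [abs_neg] at h2
    rw [abs_of_nonneg hρ.1] at h1 h2
    have h3 : φ' ρ - φ' (-ρ) - (2 * ρ) • c =
        (φ' ρ - φ' 0 - ρ • c) - (φ' (-ρ) - φ' 0 - (-ρ) • c) := by
      module
    rw [h3]
    refine (norm_sub_le _ _).trans ?_
    nlinarith [hρ.2]
  have hmv := norm_image_sub_le_of_norm_deriv_le_segment' hψ hb r ⟨hr.1.le, le_rfl⟩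
  have hr2 : 0 < r ^ 2 := pow_pos hr.1 2
  have h5 : (r ^ 2)⁻¹ • (φ r + φ (-r) - (φ 0 + φ 0)) - c =
      (r ^ 2)⁻¹ • (φ r + φ (-r) - r ^ 2 • c - (φ 0 + φ (-0) - (0 : ℝ) ^ 2 • c)) := by
    rw [neg_zero, zero_pow two_ne_zero, zero_smul, sub_zero, sub_right_comm, smul_sub _ _ (r ^ 2 • c),
      smul_smul, inv_mul_cancel₀ hr2.ne', one_smul]
  rw [dist_eq_norm, h5, norm_smul, norm_inv, Real.norm_of_nonneg hr2.le, inv_mul_lt_iff₀ hr2]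
  refine hmv.trans_lt ?_
  nlinarith

theorem norm_second_difference_le {φ φ' φ'' : ℝ → F} {ρ B : ℝ} (hρ : 0 ≤ ρ)
    (h : ∀ r ∈ Set.Icc (-ρ) ρ, HasDerivAt φ (φ' r) r)
    (h' : ∀ r ∈ Set.Icc (-ρ) ρ, HasDerivAt φ' (φ'' r) r)
    (hB : ∀ r ∈ Set.Icc (-ρ) ρ, ‖φ'' r‖ ≤ B) :
    ‖φ ρ + φ (-ρ) - (φ 0 + φ 0)‖ ≤ 2 * B * ρ ^ 2 := by
  have hB0 : 0 ≤ B := (norm_nonneg _).trans (hB 0 ⟨by linarith, hρ⟩)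
  have hφ' : ∀ r ∈ Set.Icc (0 : ℝ) ρ, ‖φ' r - φ' (-r)‖ ≤ 2 * B * ρ := by
    intro r hr
    have h1 : r ∈ Set.Icc (-ρ) ρ := ⟨by linarith [hr.1], hr.2⟩
    have h2 : -r ∈ Set.Icc (-ρ) ρ := ⟨by linarith [hr.2], by linarith [hr.1]⟩
    have := (convex_Icc (-ρ) ρ).norm_image_sub_le_of_norm_hasDerivWithin_le
      (fun x hx => (h' x hx).hasDerivWithinAt) hB h2 h1
    refine this.trans ?_
    rw [sub_neg_eq_add, Real.norm_of_nonneg (by linarith [hr.1])]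
    nlinarith [hr.2]
  have hψ : ∀ r ∈ Set.Icc (0 : ℝ) ρ, HasDerivWithinAt (fun r => φ r + φ (-r))
      (φ' r - φ' (-r)) (Set.Icc 0 ρ) r := by
    intro r hr
    exact (hasDerivAt_add_comp_neg (h r ⟨by linarith [hr.1], hr.2⟩)
      (h (-r) ⟨by linarith [hr.2], by linarith [hr.1]⟩)).hasDerivWithinAt
  have hmv := norm_image_sub_le_of_norm_deriv_le_segment' hψ
    (fun r hr => hφ' r ⟨hr.1, hr.2.le⟩) ρ ⟨hρ, le_rfl⟩
  rw [neg_zero] at hmv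
  linarith

theorem hasDerivAt_line (z e : F) (r : ℝ) : HasDerivAt (fun r : ℝ => z + r • e) e r := by
  have := ((hasDerivAt_id' r).smul_const e).const_add z
  rwa [one_smul] at this

theorem tendsto_second_difference_of_contDiffAt {E : Type*} [NormedAddCommGroup E]
    [NormedSpace ℝ E] {f : E → F} {z : E} (h : ContDiffAt ℝ 2 f z) (e : E) :
    Tendsto (fun r : ℝ => (r ^ 2)⁻¹ • (f (z + r • e) + f (z - r • e) - (f z + f z)))
      (𝓝[>] 0) (𝓝 (iteratedFDeriv ℝ 2 f z ![e, e])) := by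
  have hline := hasDerivAt_line z e
  have hlim : Tendsto (fun r : ℝ => z + r • e) (𝓝 0) (𝓝 z) := by
    have := (hline 0).continuousAt.tendsto
    rwa [zero_smul, add_zero] at this
  have hd : ∀ᶠ y in 𝓝 z, DifferentiableAt ℝ f y := by
    filter_upwards [h.eventually (by simp)] with y hy
    exact hy.differentiableAt (by simp)
  have h1 : ∀ᶠ r in 𝓝 (0 : ℝ), HasDerivAt (fun r : ℝ => f (z + r • e))
      (fderiv ℝ f (z + r • e) e) r := by
    filter_upwards [hlim.eventually hd] with r hr
    exact hr.hasFDerivAt.comp_hasDerivAt r (hline r)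
  have h2 : HasDerivAt (fun r : ℝ => fderiv ℝ f (z + r • e) e)
      (iteratedFDeriv ℝ 2 f z ![e, e]) 0 := by
    have h3 : DifferentiableAt ℝ (fderiv ℝ f) (z + (0 : ℝ) • e) := by
      rw [zero_smul, add_zero]
      exact (h.fderiv_right (m := 1) (by norm_num)).differentiableAt (by simp)
    have h4 : HasDerivAt (fun r : ℝ => fderiv ℝ f (z + r • e))
        (fderiv ℝ (fderiv ℝ f) (z + (0 : ℝ) • e) e) 0 :=
      h3.hasFDerivAt.comp_hasDerivAt (0 : ℝ) (hline 0)
    have h5 := (ContinuousLinearMap.apply ℝ F e).hasFDerivAt.comp_hasDerivAt (0 : ℝ) h4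
    refine h5.congr_deriv ?_
    rw [iteratedFDeriv_two_apply, zero_smul, add_zero]
    rfl
  have := tendsto_second_difference h1 h2
  simpa [sub_eq_add_neg] using this

theorem HarmonicAt.weaklyHarmonicAt {n : ℕ} {f : Space n → F} {z : Space n}
    (h : HarmonicAt f z) : WeaklyHarmonicAt f z := by
  have hlap := h.2.eq_of_nhds
  rw [laplacian_eq_iteratedFDeriv_stdOrthonormalBasis] at hlap
  have hsum := tendsto_finsetSum Finset.univ
    fun i _ => tendsto_second_difference_of_contDiffAt h.1 (stdOrthonormalBasis ℝ (Space n) i)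
  have hlap' : ∑ i, iteratedFDeriv ℝ 2 f z
      ![stdOrthonormalBasis ℝ (Space n) i, stdOrthonormalBasis ℝ (Space n) i] = 0 := hlap
  rw [hlap'] at hsum
  refine hsum.congr fun r => ?_
  rw [secondDiff, Finset.smul_sum]

end SecondDifference

/-! ### The Poisson kernel is harmonic -/

section KernelLine

variable {n : ℕ} (z e : Space n)

/-- First derivative of the Poisson kernel along the line through `z` in direction `e`. -/
def poissonLineDeriv (r : ℝ) : ℝ :=
  Real.Gamma (((n : ℝ) + 1) / 2) / Real.pi ^ (((n : ℝ) + 1) / 2) *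
    ((‖z + r • e‖ ^ 2) ^ (-(((n : ℝ) + 1) / 2)) * (e.snd - ((n : ℝ) + 1) * (z + r • e).snd *
      inner ℝ (z + r • e) e / ‖z + r • e‖ ^ 2))

/-- Second derivative of the Poisson kernel along the line through `z` in direction `e`. -/
def poissonLineDeriv2 (r : ℝ) : ℝ :=
  Real.Gamma (((n : ℝ) + 1) / 2) / Real.pi ^ (((n : ℝ) + 1) / 2) *
    ((‖z + r • e‖ ^ 2) ^ (-(((n : ℝ) + 1) / 2)) *
      (((n : ℝ) + 1) * ((n : ℝ) + 3) * (z + r • e).snd * inner ℝ (z + r • e) e ^ 2 /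
          (‖z + r • e‖ ^ 2) ^ 2
        - 2 * ((n : ℝ) + 1) * e.snd * inner ℝ (z + r • e) e / ‖z + r • e‖ ^ 2
        - ((n : ℝ) + 1) * (z + r • e).snd * ‖e‖ ^ 2 / ‖z + r • e‖ ^ 2))

theorem poissonKernel_eq_norm_rpow : poissonKernel z.fst z.snd =
    Real.Gamma (((n : ℝ) + 1) / 2) / Real.pi ^ (((n : ℝ) + 1) / 2) *
      (z.snd * (‖z‖ ^ 2) ^ (-(((n : ℝ) + 1) / 2))) := by
  rw [poissonKernel, norm_sq_eq, Real.rpow_neg (by positivity), div_eq_mul_inv z.snd]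

theorem hasDerivAt_line_snd (r : ℝ) : HasDerivAt (fun r : ℝ => (z + r • e).snd) e.snd r :=
  hasDerivAt_line z.snd e.snd r

theorem hasDerivAt_line_norm_sq (r : ℝ) : HasDerivAt (fun r : ℝ => ‖z + r • e‖ ^ 2)
    (2 * inner ℝ (z + r • e) e) r :=
  (hasDerivAt_line z e r).norm_sq

theorem hasDerivAt_line_inner (r : ℝ) : HasDerivAt (fun r : ℝ => inner ℝ (z + r • e) e)
    (‖e‖ ^ 2) r := by
  have := (hasDerivAt_line z e r).inner ℝ (hasDerivAt_const r e)
  simpa using this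

variable {z e} in
theorem hasDerivAt_poissonKernel_line {r : ℝ} (h : z + r • e ≠ 0) :
    HasDerivAt (fun r : ℝ => poissonKernel (z + r • e).fst (z + r • e).snd)
      (poissonLineDeriv z e r) r := by
  have hq : 0 < ‖z + r • e‖ ^ 2 := by positivity
  simp only [poissonKernel_eq_norm_rpow]
  have h1 := (hasDerivAt_line_norm_sq z e r).rpow_const (p := -(((n : ℝ) + 1) / 2))
    (Or.inl hq.ne')
  refine (((hasDerivAt_line_snd z e r).mul h1).const_mul _).congr_deriv ?_
  rw [poissonLineDeriv, Real.rpow_sub_one hq.ne']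
  field_simp
  ring

variable {z e} in
theorem hasDerivAt_poissonLineDeriv {r : ℝ} (h : z + r • e ≠ 0) :
    HasDerivAt (poissonLineDeriv z e) (poissonLineDeriv2 z e r) r := by
  have hq : 0 < ‖z + r • e‖ ^ 2 := by positivity
  have h1 := (hasDerivAt_line_norm_sq z e r).rpow_const (p := -(((n : ℝ) + 1) / 2))
    (Or.inl hq.ne')
  have h2 := ((((hasDerivAt_line_snd z e r).const_mul ((n : ℝ) + 1)).mul
    (hasDerivAt_line_inner z e r)).div (hasDerivAt_line_norm_sq z e r) hq.ne').const_sub e.snd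
  have h3 := (h1.mul h2).const_mul
    (Real.Gamma (((n : ℝ) + 1) / 2) / Real.pi ^ (((n : ℝ) + 1) / 2))
  refine h3.congr_deriv ?_
  rw [poissonLineDeriv2, Real.rpow_sub_one hq.ne']
  simp only [Pi.div_apply, Pi.mul_apply]
  generalize ‖z + r • e‖ ^ 2 = q at *
  generalize q ^ (-(((n : ℝ) + 1) / 2)) = Q
  field_simp
  ring

end KernelLine

theorem abs_snd_le_norm {n : ℕ} (z : Space n) : |z.snd| ≤ ‖z‖ := by
  refine abs_le_of_sq_le_sq ?_ (norm_nonneg z)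
  rw [norm_sq_eq]
  nlinarith [sq_nonneg ‖z.fst‖]

/-- Summing over the basis by Parseval leaves the factor `(n+1)(n+3) - 2(n+1) - (n+1)² = 0`. -/
theorem sum_poissonLineDeriv2 {n : ℕ} {z : Space n} (hz : z ≠ 0) :
    ∑ i, poissonLineDeriv2 z (stdOrthonormalBasis ℝ (Space n) i) 0 = 0 := by
  have hq : ‖z‖ ^ 2 ≠ 0 := by positivity
  have h1 := sum_inner_mul_snd_basis z
  have h2 : ∑ i, inner ℝ z (stdOrthonormalBasis ℝ (Space n) i) ^ 2 = ‖z‖ ^ 2 := by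
    rw [← real_inner_self_eq_norm_sq, ← (stdOrthonormalBasis ℝ (Space n)).sum_inner_mul_inner z z]
    exact Finset.sum_congr rfl fun i _ => by rw [sq, real_inner_comm z]
  simp only [poissonLineDeriv2, zero_smul, add_zero, OrthonormalBasis.norm_eq_one]
  rw [← Finset.mul_sum, ← Finset.mul_sum, Finset.sum_sub_distrib, Finset.sum_sub_distrib,
    ← Finset.sum_div, ← Finset.mul_sum, h2, ← Finset.sum_div, Finset.sum_const, Finset.card_univ,
    Fintype.card_fin]
  have h3 : ∑ i, 2 * ((n : ℝ) + 1) * (stdOrthonormalBasis ℝ (Space n) i).snd *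
      inner ℝ z (stdOrthonormalBasis ℝ (Space n) i) = 2 * ((n : ℝ) + 1) * z.snd := by
    rw [← h1, Finset.mul_sum]
    exact Finset.sum_congr rfl fun i _ => by ring
  rw [h3, mul_eq_zero, mul_eq_zero]
  refine Or.inr (Or.inr ?_)
  rw [nsmul_eq_mul, finrank_space]
  push_cast
  field_simp
  ring

theorem half_norm_le_norm_add_smul {n : ℕ} {z e : Space n} (he : ‖e‖ = 1) {r : ℝ}
    (hr : |r| ≤ z.snd / 2) : ‖z‖ / 2 ≤ ‖z + r • e‖ := by
  have h1 := norm_sub_le (z + r • e) (r • e)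
  rw [add_sub_cancel_right, norm_smul, he, mul_one, Real.norm_eq_abs] at h1
  have h2 := (le_abs_self _).trans (abs_snd_le_norm z)
  linarith

/-- Bounding by the Poisson kernel at `z` itself gives a majorant integrable over horizontal
translates. The factor `4^{(n+1)/2}` comes from `‖z + r e‖ ≥ ‖z‖/2`, and `n + 6 = (n + 3) + 2 + 1`
from the three terms. -/
theorem abs_poissonLineDeriv2_le {n : ℕ} {z e : Space n} (hz : 0 < z.snd) (he : ‖e‖ = 1) {r : ℝ}
    (hr : |r| ≤ z.snd / 2) : |poissonLineDeriv2 z e r| ≤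
      2 * ((n : ℝ) + 1) * ((n : ℝ) + 6) * 4 ^ (((n : ℝ) + 1) / 2) / z.snd ^ 2 *
        poissonKernel z.fst z.snd := by
  have hzn : z.snd ≤ ‖z‖ := (le_abs_self _).trans (abs_snd_le_norm z)
  have hz0 : 0 < ‖z‖ := by linarith
  have hN := half_norm_le_norm_add_smul he hr
  have hb : |inner ℝ (z + r • e) e| ≤ ‖z + r • e‖ := by
    simpa [he] using abs_real_inner_le_norm (z + r • e) e
  have hT := abs_snd_le_norm (z + r • e)
  have het : |e.snd| ≤ 1 := he ▸ abs_snd_le_norm e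
  have hc : 0 < Real.Gamma (((n : ℝ) + 1) / 2) / Real.pi ^ (((n : ℝ) + 1) / 2) :=
    div_pos (Real.Gamma_pos_of_pos (by positivity)) (Real.rpow_pos_of_pos Real.pi_pos _)
  rw [poissonKernel_eq_norm_rpow, poissonLineDeriv2]
  generalize Real.Gamma (((n : ℝ) + 1) / 2) / Real.pi ^ (((n : ℝ) + 1) / 2) = c at *
  have hQ : (‖z + r • e‖ ^ 2) ^ (-(((n : ℝ) + 1) / 2)) ≤
      4 ^ (((n : ℝ) + 1) / 2) * (‖z‖ ^ 2) ^ (-(((n : ℝ) + 1) / 2)) := by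
    calc _ ≤ (‖z‖ ^ 2 / 4) ^ (-(((n : ℝ) + 1) / 2)) := by
          refine Real.rpow_le_rpow_of_nonpos (by positivity) ?_ (by
            have : (0 : ℝ) ≤ n := n.cast_nonneg
            linarith)
          nlinarith
      _ = _ := by
          rw [Real.div_rpow (by positivity) (by norm_num), Real.rpow_neg (by norm_num : (0:ℝ) ≤ 4),
            div_inv_eq_mul, mul_comm]
  have hN0 : 0 < ‖z + r • e‖ := by linarith
  generalize inner ℝ (z + r • e) e = b at *
  generalize (z + r • e).snd = T at *
  generalize ‖z + r • e‖ = N at *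
  have hb2 : b ^ 2 ≤ N ^ 2 := sq_le_sq' (abs_le.1 hb).1 (abs_le.1 hb).2
  have hmain : |((n : ℝ) + 1) * ((n : ℝ) + 3) * T * b ^ 2 / (N ^ 2) ^ 2
      - 2 * ((n : ℝ) + 1) * e.snd * b / N ^ 2 - ((n : ℝ) + 1) * T * ‖e‖ ^ 2 / N ^ 2| ≤
      ((n : ℝ) + 1) * ((n : ℝ) + 6) / N := by
    have e1 : |((n : ℝ) + 1) * ((n : ℝ) + 3) * T * b ^ 2 / (N ^ 2) ^ 2| ≤
        ((n : ℝ) + 1) * ((n : ℝ) + 3) * N * N ^ 2 / (N ^ 2) ^ 2 := by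
      rw [abs_div, abs_mul, abs_mul, abs_of_nonneg (sq_nonneg b),
        abs_of_pos (show (0 : ℝ) < (N ^ 2) ^ 2 by positivity),
        abs_of_pos (show (0 : ℝ) < ((n : ℝ) + 1) * ((n : ℝ) + 3) by positivity)]
      gcongr
    have e2 : |2 * ((n : ℝ) + 1) * e.snd * b / N ^ 2| ≤ 2 * ((n : ℝ) + 1) * 1 * N / N ^ 2 := by
      rw [abs_div, abs_mul, abs_mul, abs_of_pos (show (0 : ℝ) < N ^ 2 by positivity),
        abs_of_pos (show (0 : ℝ) < 2 * ((n : ℝ) + 1) by positivity)]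
      gcongr
    have e3 : |((n : ℝ) + 1) * T * ‖e‖ ^ 2 / N ^ 2| ≤ ((n : ℝ) + 1) * N / N ^ 2 := by
      rw [he, one_pow, mul_one, abs_div, abs_mul, abs_of_pos (show (0 : ℝ) < N ^ 2 by positivity),
        abs_of_pos (show (0 : ℝ) < (n : ℝ) + 1 by positivity)]
      gcongr
    refine (abs_sub _ _).trans ((add_le_add (abs_sub _ _) le_rfl).trans ?_)
    refine (add_le_add (add_le_add e1 e2) e3).trans (le_of_eq ?_)
    field_simp
    ring
  have hNz : ((n : ℝ) + 1) * ((n : ℝ) + 6) / N ≤ ((n : ℝ) + 1) * ((n : ℝ) + 6) / (z.snd / 2) := by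
    gcongr
    linarith
  rw [abs_mul, abs_mul, abs_of_pos hc, abs_of_nonneg (by positivity)]
  calc _ ≤ c * (4 ^ (((n : ℝ) + 1) / 2) * (‖z‖ ^ 2) ^ (-(((n : ℝ) + 1) / 2)) *
        (((n : ℝ) + 1) * ((n : ℝ) + 6) / (z.snd / 2))) := by
        gcongr
        exact hmain.trans hNz
    _ = _ := by
        field_simp

theorem ne_zero_of_norm_ge {n : ℕ} {z e : Space n} (hz : 0 < z.snd) (he : ‖e‖ = 1) {r : ℝ}
    (hr : |r| ≤ z.snd / 2) : z + r • e ≠ 0 := by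
  have h1 := half_norm_le_norm_add_smul he hr
  have h2 := (le_abs_self _).trans (abs_snd_le_norm z)
  exact norm_pos_iff.1 (by linarith)

theorem weaklyHarmonicAt_poissonKernel {n : ℕ} {z : Space n} (hz : 0 < z.snd) :
    WeaklyHarmonicAt (fun z : Space n => poissonKernel z.fst z.snd) z := by
  have hz0 : z ≠ 0 := by
    rintro rfl
    simp at hz
  have hsum := tendsto_finsetSum Finset.univ fun i _ => tendsto_second_difference
    (φ := fun r : ℝ => poissonKernel (z + r • stdOrthonormalBasis ℝ (Space n) i).fst
      (z + r • stdOrthonormalBasis ℝ (Space n) i).snd)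
    (φ' := poissonLineDeriv z (stdOrthonormalBasis ℝ (Space n) i))
    (c := poissonLineDeriv2 z (stdOrthonormalBasis ℝ (Space n) i) 0) (by
      filter_upwards [Metric.closedBall_mem_nhds (0 : ℝ) (half_pos hz)] with r hr
      rw [mem_closedBall_zero_iff, Real.norm_eq_abs] at hr
      exact hasDerivAt_poissonKernel_line
        (ne_zero_of_norm_ge hz (OrthonormalBasis.norm_eq_one _ i) hr))
    (hasDerivAt_poissonLineDeriv (by simpa using hz0))
  rw [sum_poissonLineDeriv2 hz0] at hsum
  refine hsum.congr fun r => ?_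
  rw [secondDiff, Finset.smul_sum]
  simp [sub_eq_add_neg]

theorem exists_norm_secondDiff_poissonKernel_le (n : ℕ) {t : ℝ} (ht : 0 < t) :
    ∃ C : ℝ, ∀ z : Space n, z.snd = t → ∀ r ∈ Set.Ioc 0 (t / 2),
      ‖(r ^ 2)⁻¹ • secondDiff (fun z : Space n => poissonKernel z.fst z.snd) z r‖ ≤
        C * poissonKernel z.fst z.snd := by
  set B := 2 * ((n : ℝ) + 1) * ((n : ℝ) + 6) * 4 ^ (((n : ℝ) + 1) / 2) / t ^ 2 with hB
  refine ⟨((n : ℝ) + 1) * (2 * B), ?_⟩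
  rintro z rfl r ⟨hr0, hr⟩
  have hr2 : 0 < r ^ 2 := by positivity
  have hone : ∀ i, ‖poissonKernel (z + r • stdOrthonormalBasis ℝ (Space n) i).fst
        (z + r • stdOrthonormalBasis ℝ (Space n) i).snd +
      poissonKernel (z - r • stdOrthonormalBasis ℝ (Space n) i).fst
        (z - r • stdOrthonormalBasis ℝ (Space n) i).snd -
      (poissonKernel z.fst z.snd + poissonKernel z.fst z.snd)‖ ≤
      2 * (B * poissonKernel z.fst z.snd) * r ^ 2 := by
    intro i
    have he := OrthonormalBasis.norm_eq_one (stdOrthonormalBasis ℝ (Space n)) i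
    have habs : ∀ ρ ∈ Set.Icc (-r) r, |ρ| ≤ z.snd / 2 := fun ρ hρ => (abs_le.2 hρ).trans hr
    have := norm_second_difference_le hr0.le
      (fun ρ hρ => hasDerivAt_poissonKernel_line (ne_zero_of_norm_ge ht he (habs ρ hρ)))
      (fun ρ hρ => hasDerivAt_poissonLineDeriv (ne_zero_of_norm_ge ht he (habs ρ hρ)))
      (fun ρ hρ => abs_poissonLineDeriv2_le ht he (habs ρ hρ))
    simpa [sub_eq_add_neg] using this
  rw [norm_smul, norm_inv, Real.norm_of_nonneg hr2.le, inv_mul_le_iff₀ hr2, secondDiff]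
  refine (norm_sum_le_of_le _ fun i _ => hone i).trans (le_of_eq ?_)
  rw [Finset.sum_const, Finset.card_univ, Fintype.card_fin, finrank_space, nsmul_eq_mul]
  push_cast
  ring

/-! ### Poisson integrals and the Poisson representation of bounded harmonic functions -/

/-- The Poisson integral of `h`, written so that it makes sense on the boundary, too. -/
def poissonIntegral {n : ℕ} (h : EuclideanSpace ℝ (Fin n) → ℂ) (z : Space n) : ℂ :=
  ∫ u, poissonKernel u 1 • h (z.fst - z.snd • u)

section PoissonIntegral

variable {n : ℕ} {h : EuclideanSpace ℝ (Fin n) → ℂ} {M : ℝ}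

theorem norm_poissonKernel_smul_le (x : EuclideanSpace ℝ (Fin n)) {t : ℝ} (ht : 0 < t) {c : ℂ}
    (hc : ‖c‖ ≤ M) : ‖poissonKernel x t • c‖ ≤ poissonKernel x t * M := by
  have := poissonKernel_pos x ht
  rw [norm_smul, Real.norm_of_nonneg this.le]
  gcongr

theorem continuous_poissonIntegral (hc : Continuous h) (hM : ∀ y, ‖h y‖ ≤ M) :
    Continuous (poissonIntegral h) := by
  refine continuous_of_dominated (bound := fun u => poissonKernel u 1 * M) (fun z => ?_)
    (fun z => ae_of_all _ fun u => norm_poissonKernel_smul_le u one_pos (hM _))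
    ((integrable_poissonKernel n one_pos).mul_const M) (ae_of_all _ fun u => ?_)
  · refine Continuous.aestronglyMeasurable ?_
    exact (continuous_poissonKernel one_pos).smul
      (hc.comp (by fun_prop : Continuous fun u => z.fst - z.snd • u))
  · have h1 : Continuous fun z : Space n => h (z.fst - z.snd • u) := hc.comp (by fun_prop)
    exact h1.const_smul (poissonKernel u 1)

theorem norm_poissonIntegral_le (hM : ∀ y, ‖h y‖ ≤ M) (z : Space n) :
    ‖poissonIntegral h z‖ ≤ M := by
  refine (norm_integral_le_of_norm_le ((integrable_poissonKernel n one_pos).mul_const M)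
    (ae_of_all _ fun u => norm_poissonKernel_smul_le u one_pos (hM _))).trans ?_
  rw [integral_mul_const, integral_poissonKernel n one_pos, one_mul]

theorem poissonIntegral_of_snd_eq_zero {z : Space n} (hz : z.snd = 0) :
    poissonIntegral h z = h z.fst := by
  simp only [poissonIntegral, hz, zero_smul, sub_zero]
  rw [integral_smul_const, integral_poissonKernel n one_pos, one_smul]

/-- Substitution `y = x - t u`, with the scaling of the kernel absorbing the Jacobian. -/
theorem poissonIntegral_of_snd_pos {z : Space n} (hz : 0 < z.snd) :
    poissonIntegral h z = ∫ y, poissonKernel (z.fst - y) z.snd • h y := by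
  have h1 := integral_sub_left_eq_self (fun y => poissonKernel y z.snd • h (z.fst - y)) volume z.fst
  simp only [sub_sub_cancel] at h1
  have h2 := Measure.integral_comp_smul volume
    (fun u : EuclideanSpace ℝ (Fin n) => poissonKernel u 1 • h (z.fst - z.snd • u)) z.snd⁻¹
  simp only [smul_inv_smul₀ hz.ne'] at h2
  rw [h1]
  simp only [poissonKernel_eq_scale _ hz, mul_smul]
  rw [integral_smul, h2, finrank_euclideanSpace_fin, smul_smul, abs_of_pos (by positivity),
    inv_pow, inv_inv, inv_mul_cancel₀ (pow_ne_zero n hz.ne'), one_smul, poissonIntegral]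

theorem integrable_poissonKernel_smul (hc : Continuous h) (hM : ∀ y, ‖h y‖ ≤ M)
    (x : EuclideanSpace ℝ (Fin n)) {t : ℝ} (ht : 0 < t) :
    Integrable (fun y => poissonKernel (x - y) t • h y) := by
  refine Integrable.mono' (((integrable_poissonKernel n ht).comp_sub_left x).mul_const M) ?_
    (ae_of_all _ fun y => norm_poissonKernel_smul_le _ ht (hM y))
  exact (((continuous_poissonKernel ht).comp (by fun_prop)).smul hc).aestronglyMeasurable

theorem secondDiff_poissonIntegral (hc : Continuous h) (hM : ∀ y, ‖h y‖ ≤ M) {z : Space n}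
    {r : ℝ} (hr : r ∈ Set.Ioo 0 z.snd) :
    secondDiff (poissonIntegral h) z r = ∫ y, secondDiff
      (fun z : Space n => poissonKernel z.fst z.snd) (z - WithLp.toLp 2 (y, 0)) r • h y := by
  have hz : 0 < z.snd := hr.1.trans hr.2
  have hb : ∀ i, |r * (stdOrthonormalBasis ℝ (Space n) i).snd| < z.snd := by
    intro i
    have := abs_snd_le_norm (stdOrthonormalBasis ℝ (Space n) i)
    rw [OrthonormalBasis.norm_eq_one] at this
    rw [abs_mul, abs_of_pos hr.1]
    nlinarith [hr.1, hr.2]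
  have hp : ∀ i, 0 < (z + r • stdOrthonormalBasis ℝ (Space n) i).snd := by
    intro i
    have := (abs_lt.1 (hb i)).1
    simp only [WithLp.add_snd, WithLp.smul_snd, smul_eq_mul]
    linarith
  have hm : ∀ i, 0 < (z - r • stdOrthonormalBasis ℝ (Space n) i).snd := by
    intro i
    have := (abs_lt.1 (hb i)).2
    simp only [WithLp.sub_snd, WithLp.smul_snd, smul_eq_mul]
    linarith
  have hint : ∀ w : Space n, 0 < w.snd → Integrable fun y => poissonKernel (w.fst - y) w.snd • h y :=
    fun w hw => integrable_poissonKernel_smul hc hM w.fst hw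
  have hK : ∀ y, secondDiff (fun z : Space n => poissonKernel z.fst z.snd)
      (z - WithLp.toLp 2 (y, 0)) r • h y =
      ∑ i, (poissonKernel ((z + r • stdOrthonormalBasis ℝ (Space n) i).fst - y)
          (z + r • stdOrthonormalBasis ℝ (Space n) i).snd • h y +
        poissonKernel ((z - r • stdOrthonormalBasis ℝ (Space n) i).fst - y)
          (z - r • stdOrthonormalBasis ℝ (Space n) i).snd • h y -
        (poissonKernel (z.fst - y) z.snd • h y + poissonKernel (z.fst - y) z.snd • h y)) := by
    intro y
    rw [secondDiff, Finset.sum_smul]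
    refine Finset.sum_congr rfl fun i _ => ?_
    have h1 : (WithLp.toLp 2 (y, 0) : Space n).fst = y := rfl
    have h2 : (WithLp.toLp 2 (y, 0) : Space n).snd = 0 := rfl
    simp only [h1, h2, WithLp.add_fst, WithLp.sub_fst, WithLp.smul_fst,
      WithLp.add_snd, WithLp.sub_snd, WithLp.smul_snd, sub_zero, sub_smul, add_smul, sub_add_eq_add_sub, sub_right_comm]
  simp only [hK]
  rw [integral_finsetSum, secondDiff]
  · refine Finset.sum_congr rfl fun i _ => ?_
    rw [integral_sub, integral_add, integral_add, poissonIntegral_of_snd_pos (hp i),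
      poissonIntegral_of_snd_pos (hm i), poissonIntegral_of_snd_pos hz]
    · exact hint z hz
    · exact hint z hz
    · exact hint _ (hp i)
    · exact hint _ (hm i)
    · exact (hint _ (hp i)).add (hint _ (hm i))
    · exact (hint z hz).add (hint z hz)
  · intro i _
    exact ((hint _ (hp i)).add (hint _ (hm i))).sub ((hint z hz).add (hint z hz))

/-- The normalized second differences of the kernel tend to `0` pointwise and are dominated by `C *
P(x - y, t)`, so dominated convergence applies. -/
theorem weaklyHarmonicAt_poissonIntegral (hc : Continuous h) (hM : ∀ y, ‖h y‖ ≤ M) {z : Space n}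
    (hz : 0 < z.snd) : WeaklyHarmonicAt (poissonIntegral h) z := by
  obtain ⟨C, hC⟩ := exists_norm_secondDiff_poissonKernel_le n hz
  have hlim : Tendsto (fun r : ℝ => ∫ y, ((r ^ 2)⁻¹ • secondDiff
      (fun z : Space n => poissonKernel z.fst z.snd) (z - WithLp.toLp 2 (y, 0)) r) • h y)
      (𝓝[>] 0) (𝓝 (∫ _ : EuclideanSpace ℝ (Fin n), (0 : ℂ))) := by
    refine tendsto_integral_filter_of_dominated_convergence
      (fun y => C * poissonKernel (z.fst - y) z.snd * M) ?_ ?_ ?_ ?_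
    · filter_upwards [Ioo_mem_nhdsGT hz] with r hr
      have hK : Measurable fun y : EuclideanSpace ℝ (Fin n) => (r ^ 2)⁻¹ • secondDiff
          (fun z : Space n => poissonKernel z.fst z.snd) (z - WithLp.toLp 2 (y, 0)) r := by
        unfold secondDiff poissonKernel
        fun_prop
      exact hK.aestronglyMeasurable.smul hc.aestronglyMeasurable
    · filter_upwards [Ioc_mem_nhdsGT (half_pos hz)] with r hr
      refine ae_of_all _ fun y => ?_
      have := hC (z - WithLp.toLp 2 (y, 0)) (by simp) r hr
      rw [show poissonKernel (z - WithLp.toLp 2 (y, 0) : Space n).fst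
        (z - WithLp.toLp 2 (y, 0) : Space n).snd = poissonKernel (z.fst - y) z.snd by simp] at this
      rw [norm_smul]
      exact mul_le_mul this (hM y) (norm_nonneg _) ((norm_nonneg _).trans this)
    · exact (((integrable_poissonKernel n hz).comp_sub_left z.fst).const_mul C).mul_const M
    · refine ae_of_all _ fun y => ?_
      have hz' : 0 < (z - WithLp.toLp 2 (y, 0) : Space n).snd := by simpa using hz
      have := (weaklyHarmonicAt_poissonKernel hz').smul_const (h y)
      rwa [zero_smul] at this
  rw [integral_zero] at hlim
  refine hlim.congr' ?_
  filter_upwards [Ioo_mem_nhdsGT hz] with r hr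
  rw [secondDiff_poissonIntegral hc hM hr, ← integral_smul]
  simp only [smul_assoc]

end PoissonIntegral

/-- The Poisson representation of a harmonic function on a half space on which it is bounded. -/
theorem eq_integral_poissonKernel_smul {n : ℕ} {g : Space n → ℂ}
    (hg : HarmonicOnNhd g (upperHalfSpace n)) {s M : ℝ} (hs : 0 < s)
    (hM : ∀ z : Space n, s ≤ z.snd → ‖g z‖ ≤ M) (x : EuclideanSpace ℝ (Fin n)) {τ : ℝ}
    (hτ : 0 < τ) : g (WithLp.toLp 2 (x, τ + s)) =
      ∫ y, poissonKernel (x - y) τ • g (WithLp.toLp 2 (y, s)) := by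
  set a : Space n := WithLp.toLp 2 (0, s) with ha
  let h : EuclideanSpace ℝ (Fin n) → ℂ := fun y => g (WithLp.toLp 2 (y, s))
  have hh : ∀ y, ‖h y‖ ≤ M := fun y => hM _ le_rfl
  have hc : Continuous h :=
    hg.continuousOn.comp_continuous (f := fun y => (WithLp.toLp 2 (y, s) : Space n))
      (by fun_prop) fun y => hs
  have hsnd : ∀ z : Space n, (z + a).snd = z.snd + s := fun z => rfl
  -- Shifting by `a` moves height `s` to the boundary; the difference is then bounded by `2M`,
  -- continuous up to the boundary and zero on it.
  have hv := eq_zero_of_weaklyHarmonic (v := fun z => g (z + a) - poissonIntegral h z)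
    (M := M + M) (z := WithLp.toLp 2 (x, τ)) ?_ ?_ ?_ ?_ hτ.le
  · rw [sub_eq_zero, poissonIntegral_of_snd_pos (z := WithLp.toLp 2 (x, τ)) hτ] at hv
    refine Eq.trans ?_ hv
    congr 1
    refine WithLp.ofLp_injective 2 (Prod.ext ?_ rfl)
    simp [ha]
  · refine ContinuousOn.sub ?_ (continuous_poissonIntegral hc hh).continuousOn
    refine hg.continuousOn.comp (by fun_prop) fun z hz => ?_
    change 0 < (z + a).snd
    rw [hsnd]
    exact add_pos_of_nonneg_of_pos hz hs
  · intro z hz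
    refine WeaklyHarmonicAt.sub ?_ (weaklyHarmonicAt_poissonIntegral hc hh hz)
    have h1 : WeaklyHarmonicAt g (z + a) := HarmonicAt.weaklyHarmonicAt (hg _ (by
      change 0 < (z + a).snd
      rw [hsnd]
      exact add_pos hz hs))
    refine Tendsto.congr (fun r => ?_) h1
    simp only [secondDiff, add_right_comm z a, sub_add_eq_add_sub]
  · intro z hz
    rw [sub_eq_zero, poissonIntegral_of_snd_eq_zero hz]
    change g _ = g _
    congr 1
    refine WithLp.ofLp_injective 2 (Prod.ext ?_ ?_)
    · simp [ha]
    · change z.snd + s = s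
      rw [hz, zero_add]
  · intro z hz
    refine (norm_sub_le _ _).trans (add_le_add (hM _ ?_) (norm_poissonIntegral_le hh z))
    rw [hsnd]
    linarith

/-! ### Normal derivatives of harmonic functions of restricted growth -/

section NormalDerivative

variable {n : ℕ}

/-- Differentiation under the integral: for `t` in `(τ/2, 2τ)` the kernels are dominated by a
multiple of `P(·, τ/2)`. -/
theorem hasDerivAt_integral_poissonDeriv_smul {h : EuclideanSpace ℝ (Fin n) → ℂ} {M : ℝ}
    (hc : Continuous h) (hM : ∀ y, ‖h y‖ ≤ M) (j : ℕ) (x : EuclideanSpace ℝ (Fin n)) {τ : ℝ}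
    (hτ : 0 < τ) : HasDerivAt (fun τ => ∫ y, poissonDeriv j (x - y) τ • h y)
      (∫ y, poissonDeriv (j + 1) (x - y) τ • h y) τ := by
  have hM0 : 0 ≤ M := (norm_nonneg _).trans (hM 0)
  have hcont : ∀ (i : ℕ) {t : ℝ}, 0 < t → Continuous fun y => poissonDeriv i (x - y) t • h y :=
    fun i t ht => ((continuous_poissonDeriv i ht).comp (by fun_prop)).smul hc
  obtain ⟨C₀, hC₀, hb₀⟩ := exists_abs_poissonDeriv_le n j
  obtain ⟨C, hC, hb⟩ := exists_abs_poissonDeriv_le n (j + 1)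
  have hτ2 : 0 < τ / 2 := half_pos hτ
  refine (hasDerivAt_integral_of_dominated_loc_of_deriv_le (s := Set.Ioo (τ / 2) (2 * τ))
    (F := fun t y => poissonDeriv j (x - y) t • h y)
    (F' := fun t y => poissonDeriv (j + 1) (x - y) t • h y)
    (bound := fun y => C * (τ / 2)⁻¹ ^ (j + 1) * (4 * poissonKernel (x - y) (τ / 2)) * M)
    (Ioo_mem_nhds (half_lt_self hτ) (show τ < 2 * τ by linarith)) ?_ ?_ ?_ ?_ ?_ ?_).2
  · filter_upwards [lt_mem_nhds hτ] with t ht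
    exact (hcont j ht).aestronglyMeasurable
  · refine Integrable.mono' ((((integrable_poissonKernel n hτ).comp_sub_left x).const_mul
      (C₀ * τ⁻¹ ^ j)).mul_const M) (hcont j hτ).aestronglyMeasurable (ae_of_all _ fun y => ?_)
    have hP := poissonKernel_pos (x - y) hτ
    rw [norm_smul]
    exact mul_le_mul (hb₀ _ _ hτ) (hM y) (norm_nonneg _) (by positivity)
  · exact (hcont (j + 1) hτ).aestronglyMeasurable
  · refine ae_of_all _ fun y t ht => ?_
    have ht0 : 0 < t := hτ2.trans ht.1
    have hP := poissonKernel_pos (x - y) ht0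
    have hP2 := poissonKernel_pos (x - y) hτ2
    rw [norm_smul]
    refine mul_le_mul ((hb _ _ ht0).trans ?_) (hM y) (norm_nonneg _) (by positivity)
    gcongr
    · exact ht.1.le
    · exact poissonKernel_le_of_mem_Icc (x - y) hτ ⟨ht.1.le, ht.2.le⟩
  · exact ((((integrable_poissonKernel n hτ2).comp_sub_left x).const_mul 4).const_mul
      (C * (τ / 2)⁻¹ ^ (j + 1))).mul_const M
  · exact ae_of_all _ fun y t ht =>
      (hasDerivAt_poissonDeriv j (x - y) (hτ2.trans ht.1)).smul_const (h y)

theorem norm_le_of_growth {g : Space n → ℂ} {C l : ℝ}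
    (hC : ∀ z ∈ upperHalfSpace n, ‖g z‖ * z.snd ^ l ≤ C) {z : Space n} (hz : 0 < z.snd) :
    ‖g z‖ ≤ C * z.snd ^ (-l) := by
  rw [Real.rpow_neg hz.le, ← div_eq_mul_inv, le_div_iff₀ (Real.rpow_pos_of_pos hz l)]
  exact hC z hz

theorem nonneg_of_growth {g : Space n → ℂ} {C l : ℝ}
    (hC : ∀ z ∈ upperHalfSpace n, ‖g z‖ * z.snd ^ l ≤ C) : 0 ≤ C := by
  have h := hC (WithLp.toLp 2 (0, 1)) (show (0 : ℝ) < 1 from one_pos)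
  refine (mul_nonneg (norm_nonneg _) (Real.rpow_nonneg ?_ _)).trans h
  exact zero_le_one

theorem norm_le_of_growth_of_le {g : Space n → ℂ} {C l : ℝ}
    (hC : ∀ z ∈ upperHalfSpace n, ‖g z‖ * z.snd ^ l ≤ C) (hl : 0 ≤ l) {s : ℝ} (hs : 0 < s)
    {z : Space n} (hz : s ≤ z.snd) : ‖g z‖ ≤ C * s ^ (-l) := by
  refine (norm_le_of_growth hC (hs.trans_le hz)).trans ?_
  exact mul_le_mul_of_nonneg_left (Real.rpow_le_rpow_of_nonpos hs hz (by linarith))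
    (nonneg_of_growth hC)

theorem continuous_horizontal {g : Space n → ℂ} (hg : HarmonicOnNhd g (upperHalfSpace n)) {s : ℝ}
    (hs : 0 < s) : Continuous fun y : EuclideanSpace ℝ (Fin n) => g (WithLp.toLp 2 (y, s)) :=
  hg.continuousOn.comp_continuous (f := fun y => (WithLp.toLp 2 (y, s) : Space n))
    (by fun_prop) fun _ => hs

/-- The `j`-th normal derivative of `g` at height `τ + s` as an integral at height `s`. -/
theorem iteratedDeriv_vertical_eq_integral {g : Space n → ℂ} {C l : ℝ}
    (hg : HarmonicOnNhd g (upperHalfSpace n))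
    (hC : ∀ z ∈ upperHalfSpace n, ‖g z‖ * z.snd ^ l ≤ C) (hl : 0 ≤ l) (j : ℕ)
    (x : EuclideanSpace ℝ (Fin n)) {τ s : ℝ} (hτ : 0 < τ) (hs : 0 < s) :
    iteratedDeriv j (fun t => g (WithLp.toLp 2 (x, t))) (τ + s) =
      ∫ y, poissonDeriv j (x - y) τ • g (WithLp.toLp 2 (y, s)) := by
  have hM := fun z : Space n => norm_le_of_growth_of_le hC hl hs (z := z)
  induction j generalizing τ with
  | zero =>
    simp only [iteratedDeriv_zero, poissonDeriv_zero]
    exact eq_integral_poissonKernel_smul hg hs hM x hτ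
  | succ j ih =>
    have hd := hasDerivAt_integral_poissonDeriv_smul (continuous_horizontal hg hs)
      (fun y => hM (WithLp.toLp 2 (y, s)) le_rfl) j x hτ
    -- The height `s` stays fixed while `τ = t - s` varies, so only the kernel is differentiated.
    have hev : iteratedDeriv j (fun t => g (WithLp.toLp 2 (x, t))) =ᶠ[𝓝 (τ + s)]
        fun t => ∫ y, poissonDeriv j (x - y) (t - s) • g (WithLp.toLp 2 (y, s)) := by
      filter_upwards [lt_mem_nhds (show s < τ + s by linarith)] with t ht
      have := ih (τ := t - s) (by linarith)
      rwa [sub_add_cancel] at this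
    have hd' : HasDerivAt (fun t => ∫ y, poissonDeriv j (x - y) (t - s) •
        g (WithLp.toLp 2 (y, s))) (∫ y, poissonDeriv (j + 1) (x - y) τ •
        g (WithLp.toLp 2 (y, s))) (τ + s) := by
      have h1 : ∀ u, u = τ → HasDerivAt (fun τ => ∫ y, poissonDeriv j (x - y) τ •
          g (WithLp.toLp 2 (y, s))) (∫ y, poissonDeriv (j + 1) (x - y) τ •
          g (WithLp.toLp 2 (y, s))) u := by
        rintro u rfl
        exact hd
      exact (h1 (τ + s - s) (add_sub_cancel_right τ s)).comp_sub_const (τ + s) s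
    rw [iteratedDeriv_succ, hev.deriv_eq, hd'.deriv]

theorem hasDerivAt_iteratedDeriv_vertical {g : Space n → ℂ} {C l : ℝ}
    (hg : HarmonicOnNhd g (upperHalfSpace n))
    (hC : ∀ z ∈ upperHalfSpace n, ‖g z‖ * z.snd ^ l ≤ C) (hl : 0 ≤ l) (j : ℕ)
    (x : EuclideanSpace ℝ (Fin n)) {t : ℝ} (ht : 0 < t) :
    HasDerivAt (iteratedDeriv j fun t => g (WithLp.toLp 2 (x, t)))
      (iteratedDeriv (j + 1) (fun t => g (WithLp.toLp 2 (x, t))) t) t := by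
  have hs : 0 < t / 2 := half_pos ht
  have hM := fun y => norm_le_of_growth_of_le hC hl hs (z := WithLp.toLp 2 (y, t / 2)) le_rfl
  have hd := hasDerivAt_integral_poissonDeriv_smul (continuous_horizontal hg hs) hM j x hs
  have h1 := iteratedDeriv_vertical_eq_integral hg hC hl (j + 1) x hs hs
  rw [add_halves] at h1
  rw [h1]
  have hev : iteratedDeriv j (fun t => g (WithLp.toLp 2 (x, t))) =ᶠ[𝓝 t]
      fun τ => ∫ y, poissonDeriv j (x - y) (τ - t / 2) • g (WithLp.toLp 2 (y, t / 2)) := by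
    filter_upwards [lt_mem_nhds (show t / 2 < t by linarith)] with τ hτ
    have := iteratedDeriv_vertical_eq_integral hg hC hl j x (τ := τ - t / 2) (by linarith) hs
    rwa [sub_add_cancel] at this
  refine HasDerivAt.congr_of_eventuallyEq ?_ hev
  have h2 : ∀ u, u = t / 2 → HasDerivAt (fun τ => ∫ y, poissonDeriv j (x - y) τ •
      g (WithLp.toLp 2 (y, t / 2))) (∫ y, poissonDeriv (j + 1) (x - y) (t / 2) •
      g (WithLp.toLp 2 (y, t / 2))) u := by
    rintro u rfl
    exact hd
  exact (h2 (t - t / 2) (sub_half t)).comp_sub_const t (t / 2)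

/-- In the representation with `τ = s = t/2`, the kernel contributes `t^{-j}`, the function
`t^{-l}`, and the kernel has mass one. -/
theorem exists_norm_iteratedDeriv_vertical_le {g : Space n → ℂ} {C l : ℝ}
    (hg : HarmonicOnNhd g (upperHalfSpace n))
    (hC : ∀ z ∈ upperHalfSpace n, ‖g z‖ * z.snd ^ l ≤ C) (hl : 0 ≤ l) (j : ℕ) :
    ∃ B : ℝ, 0 ≤ B ∧ ∀ (x : EuclideanSpace ℝ (Fin n)) (t : ℝ), 0 < t →
      ‖iteratedDeriv j (fun t => g (WithLp.toLp 2 (x, t))) t‖ ≤ B * t ^ (-((j : ℝ) + l)) := by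
  obtain ⟨D, hD, hb⟩ := exists_abs_poissonDeriv_le n j
  have hC0 := nonneg_of_growth hC
  refine ⟨D * C * (2⁻¹ : ℝ) ^ (-((j : ℝ) + l)), by positivity, fun x t ht => ?_⟩
  have hs : 0 < t / 2 := half_pos ht
  have hM := fun y => norm_le_of_growth_of_le hC hl hs (z := WithLp.toLp 2 (y, t / 2)) le_rfl
  have h1 := iteratedDeriv_vertical_eq_integral hg hC hl j x hs hs
  rw [add_halves] at h1
  rw [h1]
  have h2 : ‖∫ y, poissonDeriv j (x - y) (t / 2) • g (WithLp.toLp 2 (y, t / 2))‖ ≤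
      ∫ y, D * (t / 2)⁻¹ ^ j * poissonKernel (x - y) (t / 2) * (C * (t / 2) ^ (-l)) := by
    refine norm_integral_le_of_norm_le ((((integrable_poissonKernel n hs).comp_sub_left x).const_mul
      _).mul_const _) (ae_of_all _ fun y => ?_)
    have hP := poissonKernel_pos (x - y) hs
    rw [norm_smul]
    exact mul_le_mul (hb _ _ hs) (hM y) (norm_nonneg _) (by positivity)
  refine h2.trans (le_of_eq ?_)
  rw [integral_mul_const, integral_const_mul,
    integral_sub_left_eq_self (fun y => poissonKernel y (t / 2)) volume x,
    integral_poissonKernel n hs]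
  have h3 : (t / 2)⁻¹ ^ j * (t / 2) ^ (-l) = (2⁻¹ : ℝ) ^ (-((j : ℝ) + l)) * t ^ (-((j : ℝ) + l)) := by
    rw [← Real.mul_rpow (by norm_num) ht.le, inv_mul_eq_div, neg_add, Real.rpow_add hs,
      Real.rpow_neg hs.le (j : ℝ), Real.rpow_natCast, inv_pow]
  linear_combination D * C * h3

end NormalDerivative

/-! ### A reproducing formula on the half line -/

theorem integrableOn_pow_smul {γ : ℝ → ℂ} {B l : ℝ} {k : ℕ} (hl : 0 < l)
    (hc : ContinuousOn γ (Set.Ioi 0)) (hB0 : 0 ≤ B)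
    (hB : ∀ t, 0 < t → ‖γ t‖ ≤ B * t ^ (-(((k + 1 : ℕ) : ℝ) + l))) {t : ℝ} (ht : 0 < t) :
    IntegrableOn (fun σ : ℝ => σ ^ k • γ (t + 2 * σ)) (Set.Ioi 0) := by
  have h1 : IntegrableOn (fun σ : ℝ => B * (σ + t) ^ (-(1 + l))) (Set.Ioi 0) :=
    (integrableOn_add_rpow_Ioi_of_lt (by linarith) (by linarith)).const_mul B
  refine Integrable.mono' h1 ?_ ?_
  · have h2 : ContinuousOn (fun σ : ℝ => t + 2 * σ) (Set.Ioi 0) := by fun_prop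
    have h3 : ContinuousOn (fun σ : ℝ => σ ^ k) (Set.Ioi 0) := by fun_prop
    refine (h3.smul (hc.comp h2 fun σ hσ => ?_)).aestronglyMeasurable measurableSet_Ioi
    have : (0 : ℝ) < σ := hσ
    exact Set.mem_Ioi.2 (by positivity)
  · refine (ae_restrict_iff' measurableSet_Ioi).2 (ae_of_all _ fun σ hσ => ?_)
    have hσ : (0 : ℝ) < σ := hσ
    have h2 : 0 < t + 2 * σ := by positivity
    rw [norm_smul, Real.norm_of_nonneg (by positivity)]
    calc σ ^ k * ‖γ (t + 2 * σ)‖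
        ≤ (t + 2 * σ) ^ k * (B * (t + 2 * σ) ^ (-(((k + 1 : ℕ) : ℝ) + l))) := by
          gcongr
          · linarith
          · exact hB _ h2
      _ = B * (t + 2 * σ) ^ (-(1 + l)) := by
          rw [mul_left_comm, ← Real.rpow_natCast (t + 2 * σ) k, ← Real.rpow_add h2]
          congr 2
          push_cast
          ring
      _ ≤ B * (σ + t) ^ (-(1 + l)) := by
          refine mul_le_mul_of_nonneg_left ?_ hB0
          exact Real.rpow_le_rpow_of_nonpos (by positivity) (by linarith) (by linarith)

theorem tendsto_pow_smul_atTop {γ : ℝ → ℂ} {B l : ℝ} {k : ℕ} (hl : 0 < l) (hB0 : 0 ≤ B)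
    (hB : ∀ t, 0 < t → ‖γ t‖ ≤ B * t ^ (-((k : ℝ) + l))) {t : ℝ} (ht : 0 < t) :
    Tendsto (fun σ : ℝ => σ ^ k • γ (t + 2 * σ)) atTop (𝓝 0) := by
  have h0 : Tendsto (fun σ : ℝ => B * σ ^ (-l)) atTop (𝓝 0) := by
    simpa using (tendsto_rpow_neg_atTop hl).const_mul B
  refine squeeze_zero_norm' ?_ h0
  filter_upwards [eventually_gt_atTop 0] with σ hσ
  have h2 : 0 < t + 2 * σ := by positivity
  have hk : (0 : ℝ) ≤ k := k.cast_nonneg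
  rw [norm_smul, Real.norm_of_nonneg (by positivity)]
  calc σ ^ k * ‖γ (t + 2 * σ)‖ ≤ σ ^ k * (B * σ ^ (-((k : ℝ) + l))) := by
        gcongr
        refine (hB _ h2).trans (mul_le_mul_of_nonneg_left ?_ hB0)
        exact Real.rpow_le_rpow_of_nonpos hσ (by linarith) (by linarith)
    _ = B * σ ^ (-l) := by
        rw [mul_left_comm, ← Real.rpow_natCast σ k, ← Real.rpow_add hσ]
        congr 2
        ring

/-- A function on the half line decaying like `t^{-l}` together with its derivatives is recovered
from its derivative of order `k + 1`. -/
theorem integral_pow_smul_deriv_eq {γ : ℕ → ℝ → ℂ} {l : ℝ} (hl : 0 < l)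
    (hd : ∀ j t, 0 < t → HasDerivAt (γ j) (γ (j + 1) t) t)
    (hB : ∀ j, ∃ B, 0 ≤ B ∧ ∀ t, 0 < t → ‖γ j t‖ ≤ B * t ^ (-((j : ℝ) + l))) (k : ℕ) {t : ℝ}
    (ht : 0 < t) :
    ((-2) ^ (k + 1) / (k.factorial : ℝ)) • ∫ σ in Set.Ioi (0 : ℝ), σ ^ k • γ (k + 1) (t + 2 * σ) =
      γ 0 t := by
  have hint : ∀ k, IntegrableOn (fun σ : ℝ => σ ^ k • γ (k + 1) (t + 2 * σ)) (Set.Ioi 0) := by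
    intro k
    obtain ⟨B, hB0, hB⟩ := hB (k + 1)
    exact integrableOn_pow_smul hl
      (fun τ hτ => (hd (k + 1) τ hτ).continuousAt.continuousWithinAt) hB0 hB ht
  have hlim : ∀ k, Tendsto (fun σ : ℝ => σ ^ k • γ k (t + 2 * σ)) atTop (𝓝 0) := by
    intro k
    obtain ⟨B, hB0, hB⟩ := hB k
    exact tendsto_pow_smul_atTop hl hB0 hB ht
  have hline : ∀ j σ, 0 ≤ σ → HasDerivAt (fun σ : ℝ => γ j (t + 2 * σ))
      ((2 : ℝ) • γ (j + 1) (t + 2 * σ)) σ := by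
    intro j σ hσ
    have h1 : HasDerivAt (fun σ : ℝ => t + 2 * σ) 2 σ := by
      simpa using ((hasDerivAt_id σ).const_mul 2).const_add t
    exact (hd j (t + 2 * σ) (by positivity)).scomp σ h1
  induction k with
  | zero =>
    have h2 : IntegrableOn (fun σ : ℝ => (2 : ℝ) • γ 1 (t + 2 * σ)) (Set.Ioi 0) := by
      have := (hint 0).smul (2 : ℝ)
      simp only [pow_zero, one_smul] at this
      exact this
    have h := integral_Ioi_of_hasDerivAt_of_tendsto (f := fun σ : ℝ => γ 0 (t + 2 * σ))
      (hline 0 0 le_rfl).continuousAt.continuousWithinAt (fun σ hσ => hline 0 σ (le_of_lt hσ))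
      h2 (by simpa using hlim 0)
    rw [integral_smul] at h
    simp only [pow_zero, one_smul, zero_add, pow_one, Nat.factorial_zero, Nat.cast_one, div_one,
      neg_smul, h]
    simp
  | succ k ih =>
    -- This function vanishes at `0` and at infinity. Integrating its derivative gives `2 I_{k+1} =
    -- -(k+1) I_k` for the integrals `I_k`, which matches the ratio `-2/(k+1)` of the normalizing
    -- constants.
    have hder : ∀ σ : ℝ, 0 ≤ σ → HasDerivAt (fun σ : ℝ => σ ^ (k + 1) • γ (k + 1) (t + 2 * σ))
        ((2 : ℝ) • (σ ^ (k + 1) • γ (k + 1 + 1) (t + 2 * σ)) +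
          ((k : ℝ) + 1) • (σ ^ k • γ (k + 1) (t + 2 * σ))) σ := by
      intro σ hσ
      refine ((hasDerivAt_pow (k + 1) σ).smul (hline (k + 1) σ hσ)).congr_deriv ?_
      simp only [smul_smul, Nat.add_sub_cancel]
      push_cast
      rw [mul_comm (σ ^ (k + 1)) 2]
    have hi1 : IntegrableOn (fun σ : ℝ => (2 : ℝ) • (σ ^ (k + 1) • γ (k + 1 + 1) (t + 2 * σ)))
        (Set.Ioi 0) := (hint (k + 1)).smul (2 : ℝ)
    have hi2 : IntegrableOn (fun σ : ℝ => ((k : ℝ) + 1) • (σ ^ k • γ (k + 1) (t + 2 * σ)))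
        (Set.Ioi 0) := (hint k).smul ((k : ℝ) + 1)
    have h := integral_Ioi_of_hasDerivAt_of_tendsto (hder 0 le_rfl).continuousAt.continuousWithinAt
      (fun σ hσ => hder σ (le_of_lt hσ)) (hi1.add hi2) (hlim (k + 1))
    rw [integral_add hi1 hi2, integral_smul,
      integral_smul, zero_pow k.succ_ne_zero, zero_smul, sub_zero, add_comm] at h
    rw [← ih]
    have hI := eq_neg_of_add_eq_zero_left h
    have hk : ((k : ℝ) + 1) ≠ 0 := by positivity
    have hf : (k.factorial : ℝ) ≠ 0 := by positivity
    have hc : (-2 : ℝ) ^ (k + 1) / (k.factorial : ℝ) =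
        (-2) ^ (k + 1) / ((k + 1).factorial : ℝ) * ((k : ℝ) + 1) := by
      rw [Nat.factorial_succ]
      push_cast
      field_simp
    rw [hc, mul_smul, hI, ← neg_smul, smul_smul, pow_succ (-2 : ℝ) (k + 1)]
    congr 1
    ring

/-! ### The reproducing formula for the Bergman kernel -/

section Reproducing

variable {n : ℕ}

theorem bergmanKernel_eq (k : ℕ) (z w : Space n) (h : 0 < z.snd + w.snd) :
    bergmanKernel k z w = (-2) ^ (k + 1) / (k.factorial : ℝ) *
      poissonDeriv (k + 1) (z.fst - w.fst) (z.snd + w.snd) := by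
  have h1 := congrFun (iteratedDeriv_comp_add_const (k + 1) (poissonKernel (z.fst - w.fst)) w.snd)
    z.snd
  rw [bergmanKernel, h1, iteratedDeriv_poissonKernel _ _ h]

/-- Near `0` the exponent `k - l > -1` decides; at infinity the majorant is `s^{-1-l}`, which needs
`l > 0`. -/
theorem integrableOn_inv_pow_mul_rpow {t l : ℝ} {k : ℕ} (ht : 0 < t) (hl : 0 < l)
    (hk : l - 1 < k) :
    IntegrableOn (fun s : ℝ => (t + s)⁻¹ ^ (k + 1) * s ^ ((k : ℝ) - l)) (Set.Ioi 0) := by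
  have hm : Measurable fun s : ℝ => (t + s)⁻¹ ^ (k + 1) * s ^ ((k : ℝ) - l) := by fun_prop
  rw [← Set.Ioc_union_Ioi_eq_Ioi (zero_le_one (α := ℝ))]
  refine IntegrableOn.union ?_ ?_
  · have h1 : IntegrableOn (fun s : ℝ => t⁻¹ ^ (k + 1) * s ^ ((k : ℝ) - l)) (Set.Ioc 0 1) :=
      ((intervalIntegrable_iff_integrableOn_Ioc_of_le zero_le_one).1
        (intervalIntegral.intervalIntegrable_rpow' (by linarith))).const_mul _
    refine Integrable.mono' h1 hm.aestronglyMeasurable ?_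
    refine (ae_restrict_iff' measurableSet_Ioc).2 (ae_of_all _ fun s hs => ?_)
    have hs0 : 0 < s := hs.1
    rw [Real.norm_of_nonneg (by positivity)]
    gcongr
    linarith
  · have h1 : IntegrableOn (fun s : ℝ => s ^ (-1 - l)) (Set.Ioi 1) :=
      integrableOn_Ioi_rpow_of_lt (by linarith) one_pos
    refine Integrable.mono' h1 hm.aestronglyMeasurable ?_
    refine (ae_restrict_iff' measurableSet_Ioi).2 (ae_of_all _ fun s hs => ?_)
    have hs0 : 0 < s := one_pos.trans hs
    rw [Real.norm_of_nonneg (by positivity)]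
    calc (t + s)⁻¹ ^ (k + 1) * s ^ ((k : ℝ) - l) ≤ s⁻¹ ^ (k + 1) * s ^ ((k : ℝ) - l) := by
          gcongr
          linarith
      _ = s ^ (-1 - l) := by
          rw [inv_pow, ← Real.rpow_natCast, ← Real.rpow_neg hs0.le, ← Real.rpow_add hs0]
          congr 1
          push_cast
          ring

theorem integrable_inv_pow_mul_rpow_mul_poissonKernel {t l : ℝ} {k : ℕ} (ht : 0 < t) (hl : 0 < l)
    (hk : l - 1 < k) (x : EuclideanSpace ℝ (Fin n)) :
    Integrable (fun p : EuclideanSpace ℝ (Fin n) × ℝ =>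
      (t + p.2)⁻¹ ^ (k + 1) * p.2 ^ ((k : ℝ) - l) * poissonKernel (x - p.1) (t + p.2))
      (volume.prod (volume.restrict (Set.Ioi 0))) := by
  have hm : Measurable fun p : EuclideanSpace ℝ (Fin n) × ℝ =>
      (t + p.2)⁻¹ ^ (k + 1) * p.2 ^ ((k : ℝ) - l) * poissonKernel (x - p.1) (t + p.2) := by
    unfold poissonKernel
    fun_prop
  refine (integrable_prod_iff' hm.aestronglyMeasurable).2 ⟨?_, ?_⟩
  · refine (ae_restrict_iff' measurableSet_Ioi).2 (ae_of_all _ fun s hs => ?_)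
    have hs : (0 : ℝ) < s := hs
    exact ((integrable_poissonKernel n (add_pos ht hs)).comp_sub_left x).const_mul
      ((t + s)⁻¹ ^ (k + 1) * s ^ ((k : ℝ) - l))
  · refine (integrableOn_inv_pow_mul_rpow ht hl hk).congr ?_
    refine (ae_restrict_iff' measurableSet_Ioi).2 (ae_of_all _ fun s hs => ?_)
    have hs : (0 : ℝ) < s := hs
    have hts : 0 < t + s := add_pos ht hs
    have h1 : ∀ y, ‖(t + s)⁻¹ ^ (k + 1) * s ^ ((k : ℝ) - l) * poissonKernel (x - y) (t + s)‖ =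
        (t + s)⁻¹ ^ (k + 1) * s ^ ((k : ℝ) - l) * poissonKernel (x - y) (t + s) := by
      intro y
      have := poissonKernel_pos (x - y) hts
      exact Real.norm_of_nonneg (by positivity)
    simp only [h1]
    rw [integral_const_mul, integral_sub_left_eq_self (fun y => poissonKernel y (t + s)) volume x,
      integral_poissonKernel n hts, mul_one]

theorem integrable_bergmanKernel_smul {g : Space n → ℂ} {C l : ℝ} {k : ℕ}
    (hg : HarmonicOnNhd g (upperHalfSpace n))
    (hC : ∀ z ∈ upperHalfSpace n, ‖g z‖ * z.snd ^ l ≤ C) (hl : 0 < l) (hk : l - 1 < k)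
    {z : Space n} (hz : 0 < z.snd) :
    Integrable (fun p : EuclideanSpace ℝ (Fin n) × ℝ =>
      (bergmanKernel k z (WithLp.toLp 2 p) * p.2 ^ k) • g (WithLp.toLp 2 p))
      (volume.prod (volume.restrict (Set.Ioi 0))) := by
  obtain ⟨D, hD, hb⟩ := exists_abs_poissonDeriv_le n (k + 1)
  have hC0 := nonneg_of_growth hC
  have hrestrict : (volume : Measure (EuclideanSpace ℝ (Fin n))).prod
      ((volume : Measure ℝ).restrict (Set.Ioi 0)) =
      (volume.prod volume).restrict (Set.univ ×ˢ Set.Ioi 0) := by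
    rw [← Measure.prod_restrict, Measure.restrict_univ]
  have hms : MeasurableSet ((Set.univ : Set (EuclideanSpace ℝ (Fin n))) ×ˢ Set.Ioi (0 : ℝ)) :=
    MeasurableSet.univ.prod measurableSet_Ioi
  have hcongr : Set.EqOn (fun p : EuclideanSpace ℝ (Fin n) × ℝ =>
      (bergmanKernel k z (WithLp.toLp 2 p) * p.2 ^ k) • g (WithLp.toLp 2 p))
      (fun p => ((-2) ^ (k + 1) / (k.factorial : ℝ) *
        poissonDeriv (k + 1) (z.fst - p.1) (z.snd + p.2) * p.2 ^ k) • g (WithLp.toLp 2 p))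
      (Set.univ ×ˢ Set.Ioi 0) := by
    intro p hp
    have hp : 0 < p.2 := hp.2
    simp only
    rw [bergmanKernel_eq k z _ (add_pos hz hp)]
    rfl
  refine Integrable.mono' ((integrable_inv_pow_mul_rpow_mul_poissonKernel hz hl hk z.fst).const_mul
    (|(-2) ^ (k + 1) / (k.factorial : ℝ)| * D * C)) ?_ ?_
  · rw [hrestrict]
    refine ContinuousOn.aestronglyMeasurable (ContinuousOn.congr ?_ hcongr) hms
    have h1 : ContinuousOn (fun p : EuclideanSpace ℝ (Fin n) × ℝ =>
        poissonDeriv (k + 1) (z.fst - p.1) (z.snd + p.2)) (Set.univ ×ˢ Set.Ioi 0) := by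
      refine (continuousOn_poissonDeriv n (k + 1)).comp
        (f := fun p : EuclideanSpace ℝ (Fin n) × ℝ => (z.fst - p.1, z.snd + p.2)) (by fun_prop)
        fun p hp => ?_
      have hp : 0 < p.2 := hp.2
      exact add_pos hz hp
    have h2 : ContinuousOn (fun p : EuclideanSpace ℝ (Fin n) × ℝ => g (WithLp.toLp 2 p))
        (Set.univ ×ˢ Set.Ioi 0) :=
      hg.continuousOn.comp (f := fun p : EuclideanSpace ℝ (Fin n) × ℝ =>
        (WithLp.toLp 2 p : Space n)) (by fun_prop) fun p hp => hp.2
    have h3 : ContinuousOn (fun p : EuclideanSpace ℝ (Fin n) × ℝ => p.2 ^ k)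
        (Set.univ ×ˢ Set.Ioi 0) := by fun_prop
    exact ((continuousOn_const.mul h1).mul h3).smul h2
  · rw [hrestrict]
    refine (ae_restrict_iff' hms).2 (ae_of_all _ fun p hp => ?_)
    have heq := hcongr hp
    simp only at heq
    have hp : 0 < p.2 := hp.2
    have hzp : 0 < z.snd + p.2 := add_pos hz hp
    have hP := poissonKernel_pos (z.fst - p.1) hzp
    have hgp : ‖g (WithLp.toLp 2 p)‖ ≤ C * p.2 ^ (-l) :=
      norm_le_of_growth hC (z := WithLp.toLp 2 p) hp
    rw [heq, norm_smul, norm_mul, norm_mul, Real.norm_eq_abs, Real.norm_eq_abs,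
      Real.norm_of_nonneg (pow_nonneg hp.le k)]
    calc _ ≤ |(-2) ^ (k + 1) / (k.factorial : ℝ)| *
          (D * (z.snd + p.2)⁻¹ ^ (k + 1) * poissonKernel (z.fst - p.1) (z.snd + p.2)) * p.2 ^ k *
          (C * p.2 ^ (-l)) := by
          gcongr
          exact hb _ _ hzp
      _ = _ := by
          rw [sub_eq_add_neg (k : ℝ) l, Real.rpow_add hp, Real.rpow_natCast]
          ring

/-! ### Fubini on the half space -/

theorem preimage_ofLp_prod (n : ℕ) :
    (WithLp.ofLp : Space n → EuclideanSpace ℝ (Fin n) × ℝ) ⁻¹' (Set.univ ×ˢ Set.Ioi 0) =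
      upperHalfSpace n := by
  ext z
  exact ⟨fun h => h.2, fun h => ⟨Set.mem_univ _, h⟩⟩

theorem volume_restrict_prod (n : ℕ) :
    (volume : Measure (EuclideanSpace ℝ (Fin n) × ℝ)).restrict (Set.univ ×ˢ Set.Ioi 0) =
      volume.prod (volume.restrict (Set.Ioi 0)) := by
  rw [Measure.volume_eq_prod, ← Measure.prod_restrict, Measure.restrict_univ]

theorem integrableOn_upperHalfSpace_iff {f : Space n → ℂ} :
    IntegrableOn f (upperHalfSpace n) ↔
      Integrable (fun p => f (WithLp.toLp 2 p)) (volume.prod (volume.restrict (Set.Ioi 0))) := by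
  have h := (WithLp.volume_preserving_ofLp (EuclideanSpace ℝ (Fin n)) ℝ).integrableOn_comp_preimage
    (MeasurableEquiv.toLp 2 (EuclideanSpace ℝ (Fin n) × ℝ)).symm.measurableEmbedding
    (f := fun p => f (WithLp.toLp 2 p)) (s := Set.univ ×ˢ Set.Ioi 0)
  rw [preimage_ofLp_prod] at h
  rw [← volume_restrict_prod]
  exact h

theorem setIntegral_upperHalfSpace {f : Space n → ℂ} (hf : IntegrableOn f (upperHalfSpace n)) :
    ∫ w in upperHalfSpace n, f w = ∫ s in Set.Ioi (0 : ℝ), ∫ y, f (WithLp.toLp 2 (y, s)) := by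
  have h := (WithLp.volume_preserving_ofLp (EuclideanSpace ℝ (Fin n)) ℝ).setIntegral_preimage_emb
    (MeasurableEquiv.toLp 2 (EuclideanSpace ℝ (Fin n) × ℝ)).symm.measurableEmbedding
    (fun p => f (WithLp.toLp 2 p)) (Set.univ ×ˢ Set.Ioi 0)
  rw [preimage_ofLp_prod, volume_restrict_prod] at h
  exact h.trans (integral_prod_symm _ (integrableOn_upperHalfSpace_iff.1 hf))

theorem integrableOn_bergmanKernel_smul {g : Space n → ℂ} {C l : ℝ} {k : ℕ}
    (hg : HarmonicOnNhd g (upperHalfSpace n))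
    (hC : ∀ z ∈ upperHalfSpace n, ‖g z‖ * z.snd ^ l ≤ C) (hl : 0 < l) (hk : l - 1 < k)
    {z : Space n} (hz : 0 < z.snd) :
    IntegrableOn (fun w => (bergmanKernel k z w * w.snd ^ k) • g w) (upperHalfSpace n) :=
  integrableOn_upperHalfSpace_iff.2 (integrable_bergmanKernel_smul hg hC hl hk hz)

/-- The Bergman kernel reproduces harmonic functions of restricted growth. -/
theorem integral_bergmanKernel_smul {g : Space n → ℂ} {C l : ℝ} {k : ℕ}
    (hg : HarmonicOnNhd g (upperHalfSpace n))
    (hC : ∀ z ∈ upperHalfSpace n, ‖g z‖ * z.snd ^ l ≤ C) (hl : 0 < l) (hk : l - 1 < k)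
    {z : Space n} (hz : 0 < z.snd) :
    ∫ w in upperHalfSpace n, (bergmanKernel k z w * w.snd ^ k) • g w = g z := by
  rw [setIntegral_upperHalfSpace (integrableOn_bergmanKernel_smul hg hC hl hk hz)]
  have hinner : ∀ s ∈ Set.Ioi (0 : ℝ),
      ∫ y, (bergmanKernel k z (WithLp.toLp 2 (y, s)) * s ^ k) • g (WithLp.toLp 2 (y, s)) =
      ((-2) ^ (k + 1) / (k.factorial : ℝ)) • (s ^ k • iteratedDeriv (k + 1)
        (fun t => g (WithLp.toLp 2 (z.fst, t))) (z.snd + 2 * s)) := by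
    intro s hs
    have hs : 0 < s := hs
    have hzs : 0 < z.snd + s := add_pos hz hs
    -- The kernel acts over the distance `t + s` and `g` is taken at height `s`, hence total height
    -- `t + 2s`.
    rw [show z.snd + 2 * s = (z.snd + s) + s by ring,
      iteratedDeriv_vertical_eq_integral hg hC hl.le (k + 1) z.fst hzs hs, ← integral_smul,
      ← integral_smul]
    refine integral_congr_ae (ae_of_all _ fun y => ?_)
    simp only
    rw [bergmanKernel_eq k z (WithLp.toLp 2 (y, s)) hzs, smul_smul, smul_smul]
    congr 1
    change _ * poissonDeriv (k + 1) (z.fst - y) (z.snd + s) * s ^ k = _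
    ring
  have h := integral_pow_smul_deriv_eq
    (γ := fun j => iteratedDeriv j fun t => g (WithLp.toLp 2 (z.fst, t))) hl
    (fun j t ht => hasDerivAt_iteratedDeriv_vertical hg hC hl.le j z.fst ht)
    (fun j => by
      obtain ⟨B, hB0, hB⟩ := exists_norm_iteratedDeriv_vertical_le hg hC hl.le j
      exact ⟨B, hB0, fun t ht => hB z.fst t ht⟩) k hz
  rw [iteratedDeriv_zero, ← integral_smul] at h
  exact (setIntegral_congr_fun measurableSet_Ioi hinner).trans h

end Reproducing

/-! ### Composition of harmonic functions with averages -/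

/-- The second derivative of the composition along `u` is that of `g` along `A u`, seen by comparing
limits of second differences. By `hA`, the Laplacian is then only multiplied by `c`. -/
theorem HarmonicAt.comp_affine {E F G κ ι : Type*} [NormedAddCommGroup E] [InnerProductSpace ℝ E]
    [FiniteDimensional ℝ E] [NormedAddCommGroup F] [InnerProductSpace ℝ F] [FiniteDimensional ℝ F]
    [NormedAddCommGroup G] [NormedSpace ℝ G] [Fintype κ] [Fintype ι] {g : F → G} (A : E →L[ℝ] F)
    (p : F) {c : ℝ} (b : OrthonormalBasis κ ℝ E) (B : OrthonormalBasis ι ℝ F)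
    (hA : ∀ Q : F →L[ℝ] F →L[ℝ] G, ∑ k, Q (A (b k)) (A (b k)) = c • ∑ i, Q (B i) (B i)) {x : E}
    (h : HarmonicAt g (A x + p)) : HarmonicAt (fun x => g (A x + p)) x := by
  have hA' : ContDiff ℝ 2 fun x => A x + p := by fun_prop
  have hcomp : ∀ y, HarmonicAt g (A y + p) → ContDiffAt ℝ 2 (fun x => g (A x + p)) y :=
    fun y hy => hy.1.comp y hA'.contDiffAt
  refine ⟨hcomp x h, ?_⟩
  filter_upwards [hA'.continuous.continuousAt.eventually h.eventually] with y hy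
  have hsecond : ∀ u : E, iteratedFDeriv ℝ 2 (fun x => g (A x + p)) y ![u, u] =
      fderiv ℝ (fderiv ℝ g) (A y + p) (A u) (A u) := by
    intro u
    have h1 := tendsto_second_difference_of_contDiffAt (hcomp y hy) u
    have h2 := tendsto_second_difference_of_contDiffAt hy.1 (A u)
    rw [iteratedFDeriv_two_apply g] at h2
    refine tendsto_nhds_unique h1 (h2.congr fun r => ?_)
    simp only [map_add, map_sub, map_smul, add_right_comm, sub_add_eq_add_sub]
  have hlap := hy.2.eq_of_nhds
  rw [laplacian_eq_iteratedFDeriv_orthonormalBasis _ B] at hlap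
  simp only [iteratedFDeriv_two_apply, Matrix.cons_val_zero, Matrix.cons_val_one,
    Pi.zero_apply] at hlap
  rw [laplacian_eq_iteratedFDeriv_orthonormalBasis _ b]
  simp only [hsecond, Pi.zero_apply]
  rw [hA, hlap, smul_zero]

section Average

variable {n m : ℕ}

theorem average_snd (z : Fin m → Space n) :
    ((m : ℝ)⁻¹ • ∑ j, z j).snd = (m : ℝ)⁻¹ * ∑ j, (z j).snd := by
  rw [snd_eq_inner, real_inner_smul_left, sum_inner]
  simp only [← snd_eq_inner]

theorem average_mem_upperHalfSpace (hm : 1 ≤ m) {z : Fin m → Space n}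
    (hz : ∀ j, z j ∈ upperHalfSpace n) : (m : ℝ)⁻¹ • ∑ j, z j ∈ upperHalfSpace n := by
  have hm0 : (0 : ℝ) < m := by exact_mod_cast hm
  change 0 < ((m : ℝ)⁻¹ • ∑ j, z j).snd
  rw [average_snd]
  have : Nonempty (Fin m) := ⟨⟨0, hm⟩⟩
  exact mul_pos (inv_pos.2 hm0) (Finset.sum_pos (fun j _ => hz j) Finset.univ_nonempty)

theorem harmonic_comp_average (hm : 1 ≤ m) {g : Space n → ℂ}
    (hg : HarmonicOnNhd g (upperHalfSpace n)) :
    (fun z : Fin m → Space n => g ((m : ℝ)⁻¹ • ∑ j, z j)) ∈ Harmonic n m := by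
  intro Z hZ
  let A : PiLp 2 (fun _ : Fin m => Space n) →L[ℝ] Space n :=
    (m : ℝ)⁻¹ • ∑ j, PiLp.proj 2 (fun _ : Fin m => Space n) j
  have hA : ∀ Z, A Z = (m : ℝ)⁻¹ • ∑ j, Z j := fun Z => by
    simp [A]
  have hb : ∀ k, A (Pi.orthonormalBasis
      (fun _ : Fin m => stdOrthonormalBasis ℝ (Space n)) k) =
      (m : ℝ)⁻¹ • stdOrthonormalBasis ℝ (Space n) k.2 := by
    rintro ⟨j, i⟩
    rw [hA, Pi.orthonormalBasis_apply]
    simp [PiLp.single_apply, Finset.sum_ite_eq']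
  -- Each of the `m` copies of the basis is mapped to the basis scaled by `m⁻¹`.
  have h := HarmonicAt.comp_affine A 0 (g := g) (c := (m : ℝ)⁻¹ ^ 2 * m)
    (Pi.orthonormalBasis (fun _ : Fin m => stdOrthonormalBasis ℝ (Space n)))
    (stdOrthonormalBasis ℝ (Space n)) (fun Q => by
      simp only [hb, map_smul, smul_apply, smul_smul, Fintype.sum_sigma,
        ← Finset.smul_sum, Finset.sum_const, Finset.card_univ, Fintype.card_fin]
      rw [← Nat.cast_smul_eq_nsmul ℝ, smul_smul]
      congr 1
      ring) (x := Z) (by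
      rw [add_zero, hA]
      exact hg _ (average_mem_upperHalfSpace hm hZ))
  simpa only [add_zero, hA] using h

theorem sepHarmonic_comp_average (hm : 1 ≤ m) {g : Space n → ℂ}
    (hg : HarmonicOnNhd g (upperHalfSpace n)) :
    (fun z : Fin m → Space n => g ((m : ℝ)⁻¹ • ∑ j, z j)) ∈ SepHarmonic n m := by
  intro z hz j ζ hζ
  have hsum : ∀ ζ, (m : ℝ)⁻¹ • ∑ i, Function.update z j ζ i =
      ((m : ℝ)⁻¹ • ContinuousLinearMap.id ℝ (Space n)) ζ +
        (m : ℝ)⁻¹ • ∑ i ∈ Finset.univ \ {j}, z i := by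
    intro ζ
    rw [Finset.sum_update_of_mem (Finset.mem_univ j), smul_add]
    rfl
  have hmem : ∀ i, Function.update z j ζ i ∈ upperHalfSpace n := by
    intro i
    rcases eq_or_ne i j with rfl | h
    · simpa using hζ
    · simpa [h] using hz i
  have h := HarmonicAt.comp_affine ((m : ℝ)⁻¹ • ContinuousLinearMap.id ℝ (Space n))
    ((m : ℝ)⁻¹ • ∑ i ∈ Finset.univ \ {j}, z i) (g := g) (c := (m : ℝ)⁻¹ ^ 2)
    (stdOrthonormalBasis ℝ (Space n)) (stdOrthonormalBasis ℝ (Space n)) (fun Q => by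
      simp only [smul_apply, ContinuousLinearMap.id_apply, map_smul, smul_smul,
        ← Finset.smul_sum, sq]) (x := ζ) (by
      rw [← hsum]
      exact hg _ (average_mem_upperHalfSpace hm hmem))
  simpa only [← hsum] using h

theorem growth_comp_average (hm : 1 ≤ m) {s : Fin m → ℝ} (hs : ∀ j, 0 ≤ s j) {g : Space n → ℂ}
    {C : ℝ} (hC : ∀ z ∈ upperHalfSpace n, ‖g z‖ * z.snd ^ (∑ j, s j) ≤ C) {z : Fin m → Space n}
    (hz : ∀ j, z j ∈ upperHalfSpace n) :
    ‖g ((m : ℝ)⁻¹ • ∑ j, z j)‖ * ∏ j, (z j).snd ^ s j ≤ C * (m : ℝ) ^ (∑ j, s j) := by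
  have hm0 : (0 : ℝ) < m := by exact_mod_cast hm
  have hpos : ∀ j, 0 < (z j).snd := hz
  have havg := average_mem_upperHalfSpace hm hz
  have ht : 0 < ((m : ℝ)⁻¹ • ∑ j, z j).snd := havg
  -- One height is at most the sum of all, as all are positive.
  have hle : ∀ j, (z j).snd ≤ m * ((m : ℝ)⁻¹ • ∑ j, z j).snd := by
    intro j
    rw [average_snd, mul_inv_cancel_left₀ hm0.ne']
    exact Finset.single_le_sum (f := fun j => (z j).snd) (fun i _ => (hpos i).le)
      (Finset.mem_univ j)
  have hprod : ∏ j, (z j).snd ^ s j ≤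
      (m : ℝ) ^ (∑ j, s j) * ((m : ℝ)⁻¹ • ∑ j, z j).snd ^ (∑ j, s j) := by
    rw [← Real.mul_rpow hm0.le ht.le, Real.rpow_sum_of_pos (mul_pos hm0 ht)]
    exact Finset.prod_le_prod (fun j _ => Real.rpow_nonneg (hpos j).le _)
      fun j _ => Real.rpow_le_rpow (hpos j).le (hle j) (hs j)
  calc _ ≤ ‖g ((m : ℝ)⁻¹ • ∑ j, z j)‖ *
        ((m : ℝ) ^ (∑ j, s j) * ((m : ℝ)⁻¹ • ∑ j, z j).snd ^ (∑ j, s j)) := by gcongr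
    _ = ‖g ((m : ℝ)⁻¹ • ∑ j, z j)‖ * ((m : ℝ)⁻¹ • ∑ j, z j).snd ^ (∑ j, s j) *
        (m : ℝ) ^ (∑ j, s j) := by ring
    _ ≤ _ := by
        gcongr
        exact hC _ havg

theorem tr_comp_average (hm : 1 ≤ m) (g : Space n → ℂ) :
    tr (fun z : Fin m → Space n => g ((m : ℝ)⁻¹ • ∑ j, z j)) = g := by
  have hm0 : (m : ℝ) ≠ 0 := by
    have : (0 : ℝ) < m := by exact_mod_cast hm
    exact this.ne'
  funext z
  simp only [tr, Finset.sum_const, Finset.card_univ, Fintype.card_fin]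
  rw [← Nat.cast_smul_eq_nsmul ℝ, inv_smul_smul₀ hm0]

theorem isOpen_prod_upperHalfSpace (n m : ℕ) :
    IsOpen {Z : PiLp 2 (fun _ : Fin m => Space n) | ∀ j, Z j ∈ upperHalfSpace n} := by
  have : {Z : PiLp 2 (fun _ : Fin m => Space n) | ∀ j, Z j ∈ upperHalfSpace n} =
      ⋂ j, (fun Z : PiLp 2 (fun _ : Fin m => Space n) => Z j) ⁻¹' upperHalfSpace n := by
    ext Z
    simp
  rw [this]
  exact isOpen_iInter_of_finite fun j => (isOpen_upperHalfSpace n).preimage (by fun_prop)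

/-- Membership in the product spaces only depends on the values on the product of half spaces. -/
theorem mem_inter_of_eqOn {s : Fin m → ℝ} {f f' : (Fin m → Space n) → ℂ}
    (hf : f ∈ ProdGrowthSpace n s ∩ SepHarmonic n m)
    (h : ∀ z, (∀ j, z j ∈ upperHalfSpace n) → f' z = f z) :
    f' ∈ ProdGrowthSpace n s ∩ SepHarmonic n m := by
  obtain ⟨⟨hh, C, hC⟩, hsep⟩ := hf
  refine ⟨⟨fun Z hZ => ?_, C, fun z hz => ?_⟩, fun z hz j ζ hζ => ?_⟩
  · refine (harmonicAt_congr_nhds ?_).1 (hh Z hZ)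
    filter_upwards [(isOpen_prod_upperHalfSpace n m).mem_nhds hZ] with W hW
    exact (h _ hW).symm
  · rw [h z hz]
    exact hC z hz
  · refine (harmonicAt_congr_nhds ?_).1 (hsep z hz j ζ hζ)
    filter_upwards [(isOpen_upperHalfSpace n).mem_nhds hζ] with ξ hξ
    refine (h _ fun i => ?_).symm
    rcases eq_or_ne i j with rfl | hij
    · simpa using hξ
    · simpa [hij] using hz i

end Average

end HarmonicTrace

end

/-! ### Extension by averages and restriction to the diagonal -/

theorem theorem5 (n m : ℕ) (hn : 1 ≤ n) (hm : 1 ≤ m) (s : Fin m → ℝ) (hs : ∀ j, -1 < s j) :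
    ((∀ j, 0 < s j) →
      HarmonicTrace.GrowthSpace n (∑ j, s j) ⊆
          HarmonicTrace.traceSet
            (HarmonicTrace.ProdGrowthSpace n s ∩ HarmonicTrace.SepHarmonic n m) ∧
        ∀ k : ℕ, (∑ j, s j) - 1 < (k : ℝ) →
          ∀ g ∈ HarmonicTrace.GrowthSpace n (∑ j, s j),
            (∀ z : Fin m → HarmonicTrace.Space n,
              (∀ j, z j ∈ HarmonicTrace.upperHalfSpace n) →
                MeasureTheory.IntegrableOn (HarmonicTrace.extensionIntegrand k g z)
                  (HarmonicTrace.upperHalfSpace n)) ∧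
            HarmonicTrace.extension m k g ∈
              HarmonicTrace.ProdGrowthSpace n s ∩ HarmonicTrace.SepHarmonic n m ∧
            Set.EqOn (HarmonicTrace.tr (HarmonicTrace.extension m k g)) g
              (HarmonicTrace.upperHalfSpace n)) ∧
    (∀ f ∈ HarmonicTrace.ProdGrowthSpace n s,
      InnerProductSpace.HarmonicOnNhd (HarmonicTrace.tr f) (HarmonicTrace.upperHalfSpace n) →
        HarmonicTrace.tr f ∈ HarmonicTrace.GrowthSpace n (∑ j, s j)) := by
  open HarmonicTrace in
  have hm0 : Nonempty (Fin m) := ⟨⟨0, hm⟩⟩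
  refine ⟨fun hpos => ?_, ?_⟩
  · have hl : 0 < ∑ j, s j := Finset.sum_pos (fun j _ => hpos j) Finset.univ_nonempty
    have havg : ∀ g ∈ GrowthSpace n (∑ j, s j),
        (fun z : Fin m → Space n => g ((m : ℝ)⁻¹ • ∑ j, z j)) ∈
          ProdGrowthSpace n s ∩ SepHarmonic n m := by
      rintro g ⟨hg, C, hC⟩
      exact ⟨⟨harmonic_comp_average hm hg, C * (m : ℝ) ^ (∑ j, s j),
        fun z hz => growth_comp_average hm (fun j => (hpos j).le) hC hz⟩,
        sepHarmonic_comp_average hm hg⟩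
    refine ⟨fun g hg => ⟨_, havg g hg, fun z _ => by rw [tr_comp_average hm]⟩, ?_⟩
    intro k hk g hg
    obtain ⟨hgh, C, hC⟩ := id hg
    -- The reproducing formula at the average identifies the integral with `g` of the average, on
    -- the product of half spaces only; `mem_inter_of_eqOn` then transfers membership.
    have hext : ∀ z : Fin m → Space n, (∀ j, z j ∈ upperHalfSpace n) →
        extension m k g z = g ((m : ℝ)⁻¹ • ∑ j, z j) := fun z hz =>
      integral_bergmanKernel_smul hgh hC hl hk (average_mem_upperHalfSpace hm hz)
    refine ⟨fun z hz => integrableOn_bergmanKernel_smul hgh hC hl hk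
      (average_mem_upperHalfSpace hm hz), mem_inter_of_eqOn (havg g hg) hext, fun z hz => ?_⟩
    exact (hext _ fun _ => hz).trans (congrFun (tr_comp_average hm g) z)
  · rintro f ⟨-, C, hC⟩ hf
    refine ⟨hf, C, fun z hz => ?_⟩
    -- On the diagonal the product weight is `t` to the power `∑ j, s j`, so the same `C` serves.
    rw [Real.rpow_sum_of_pos hz]
    exact hC _ fun _ => hz
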